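/- **Notation.** For coefficients $\alpha=(\alpha_n)_{n\ge 0}$ in $\overline{\mathbb D}$ put $\rho_n=\sqrt{1-|\alpha_n|^2}$, $\alpha_{-1}=-1$, $\rho_{-1}=0$. The CMV matrix $\mathcal C=\mathcal C(\alpha)$ is the five-diagonal operator on $\ell^2(\mathbb N_0)$ whose rows $2k$ and $2k+1$ have, in the columns $2k-1,2k,2k+1,2k+2$ (without the column $-1$ if $k=0$), the entries $$(\bar\alpha_{2k}\rho_{2k-1},\,-\bar\alpha_{2k}\alpha_{2k-1},\,\bar\alpha_{2k+1}\rho_{2k},\,\rho_{2k+1}\rho_{2k}),\qquad(\rho_{2k}\rho_{2k-1},\,-\rho_{2k}\alpha_{2k-1},\,-\bar\alpha_{2k+1}\alpha_{2k},\,-\rho_{2k+1}\alpha_{2k}),$$ and zeros elsewhere. Let $\mathcal C_n(\alpha_0,\dots,\alpha_{n-1})$ be its top-left $n\times n$ block. Off the spectrum of $\mathcal C$ put $$m(z)=\langle e_0,(z-\mathcal C)^{-1}e_0\rangle,\quad F(z)=\langle e_0,(\mathcal C+z)(\mathcal C-z)^{-1}e_0\rangle,\quad f(z)=\frac1z\,\frac{F(z)-1}{F(z)+1}\in\mathbb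 C\cup\{\infty\},$$ where $f$ (the Schur function) is extended by continuity to $z=0$ and to the isolated point masses, on the unit circle, of the spectral measure of $\mathcal C$ at $e_0$. Let $\mathcal Z(f)=\{z\in\mathbb D: f(z)=0\}$ and $\mathcal P(f)=\{z\in\mathbb C\setminus\overline{\mathbb D}: f(z)=\infty\}$. For $\alpha_{n,N}\in\mathbb D$ and $|\beta|=1$ let $\Phi_{n,N}(z)=\det(z-\mathcal C_n(\alpha_{0,N},\dots,\alpha_{n-1,N}))$, $\Phi^*_{n,N}(z)=z^n\overline{\Phi_{n,N}(1/\bar z)}$ and $\Phi^{(\beta)}_{n,N}(z)=\det(z-\mathcal C_n(\alpha_{0,N},\dots,\alpha_{n-2,N},\beta))$. For $t>0$, a limit "as $n/N\to t$" means the limit along all sequences $n_i,N_i\to\infty$ of positive integers with $n_i/N_i\to t$; a limit "as $kp/N\to t$" is the same with $n_i=k_ip$. Let $\Lambda_{\beta,t}$ be the set of those $e^{i\theta}$ for which there are sequences $n_i,N_i\to\infty$ with $n_i/N_i\to t$ and $$\liminf_{i\to\infty}\operatorname{dist}\bigl(e^{i\theta},\{z\in\partial\mathbb D:\Phi^{(\beta)}_{n_i,N_i}(z)=0\}\bigr)=0,$$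 and let $\Lambda_t=\bigcap_{|\beta|=1}\Lambda_{\beta,t}$. **Theorem.** Let $p\in\mathbb N$, $|\beta|=1$, $t>0$, let $(\alpha_n)_{n\in\mathbb Z}$ be a $p$-periodic sequence in $\mathbb D$ that is not identically zero, and let $\alpha_{n,N}\in\mathbb D$ $(n,N\in\mathbb N_0)$ satisfy $$\lim_{kp/N\to t}\alpha_{kp+j,N}=\alpha_j\qquad\text{for all } j\in\{0,\dots,p-1\}.$$ For $j\in\mathbb N_0$ and $|\gamma|=1$ let $m_\gamma^{(j)}$ and $f_\gamma^{(j)}$ be the $m$-function and the Schur function of the CMV matrix with the coefficients $-\bar\alpha_{p-1-j}\gamma,\ -\bar\alpha_{p-2-j}\gamma,\ -\bar\alpha_{p-3-j}\gamma,\dots$ (the $j$ times stripped $p$-periodic CMV matrix $\mathcal C_\gamma$ with first coefficients $-\bar\alpha_{p-1}\gamma,\dots,-\bar\alpha_0\gamma$). Then for every $j\in\mathbb N_0$ the following limits hold; in each of them the denominators on the left have no zeros on the given compact set from some index on. 1. $\displaystyle\lim_{kp/N\to t}\frac{\Phi_{kp-j,N}(z)}{\Phi^{(\beta)}_{kp-j+1,N}(z)}=m_\beta^{(j)}(z)$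 uniformly on compacts of $\mathbb C\setminus\Lambda_{\beta,t}$. 2. $\displaystyle\lim_{kp/N\to t}\frac{\Phi_{kp-j,N}(z)}{\Phi^*_{kp-j,N}(z)}=f_1^{(j)}(z)$ uniformly on compacts of $\mathbb C\setminus(\Lambda_t\cup\mathcal P(f_1^{(j)}))$. 3. $\displaystyle\lim_{kp/N\to t}\frac{\Phi^*_{kp-j+1,N}(z)}{\Phi^*_{kp-j,N}(z)}=1-z\,\alpha_{p-j}f_1^{(j)}(z)$ uniformly on compacts of $\mathbb C\setminus(\Lambda_t\cup\mathcal P(f_1^{(j)}))$. 4. $\displaystyle\lim_{kp/N\to t}\frac{\Phi_{kp-j+1,N}(z)}{\Phi_{kp-j,N}(z)}=z-\bar\alpha_{p-j}/f_1^{(j)}(z)$ uniformly on compacts of $\mathbb C\setminus(\Lambda_t\cup\mathcal Z(f_1^{(j)}))$, where $1/\infty=0$. 5. $\displaystyle\lim_{kp/N\to t}\frac{\Phi^{(\beta)}_{kp-j+1,N}(z)}{\Phi^{(\beta)}_{kp-j,N}(z)}=L(z)$ uniformly on compacts of $\mathbb C\setminus\Lambda_{\beta,t}$, where $L$ is analytic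 on $\mathbb C\setminus\Lambda_{\beta,t}$ and $$L(z)=\frac{m_\beta^{(j+1)}(z)}{m_\beta^{(j)}(z)}\Bigl(z-\bar\alpha_{p-j-1}/f_1^{(j+1)}(z)\Bigr),\qquad z\in\mathbb C\setminus\bigl(\Lambda_{\beta,t}\cup\mathcal Z(f_1^{(j)})\cup\mathcal Z(f_1^{(j+1)})\bigr),$$ $$L(z)=\frac{\overline{m_\beta^{(j+1)}(1/\bar z)}}{\overline{m_\beta^{(j)}(1/\bar z)}}\Bigl(1-z\,\alpha_{p-j-1}f_1^{(j+1)}(z)\Bigr),\qquad z\in\mathbb C\setminus\bigl(\Lambda_{\beta,t}\cup\mathcal P(f_1^{(j)})\cup\mathcal P(f_1^{(j+1)})\cup\{0\}\bigr).$$ -/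

import Mathlib

open Filter Topology Polynomial
open scoped ComplexConjugate ENNReal

noncomputable section

/-! ### Limits along `n/N → t` -/

/-- The pairs of sequences with `n i, N i → ∞` and `n i / N i → t`. -/
def RatioSeq (t : ℝ) (n N : ℕ → ℕ) : Prop :=
  Tendsto n atTop atTop ∧ Tendsto N atTop atTop ∧
    Tendsto (fun i => (n i : ℝ) / (N i : ℝ)) atTop (𝓝 t)

/-! ### CMV matrices -/

/-- Verblunsky coefficients moved up by one place, with the convention `α_{-1} = -1`:
`cmvA α (n + 1) = α n`. -/
def cmvA (α : ℕ → ℂ) : ℕ → ℂ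
  | 0 => -1
  | n + 1 => α n

/-- `cmvR α (n + 1) = ρ_n = √(1 - |α_n|²)` and `cmvR α 0 = ρ_{-1} = 0`. -/
def cmvR (α : ℕ → ℂ) (n : ℕ) : ℂ := (Real.sqrt (1 - ‖cmvA α n‖ ^ 2) : ℝ)

/-- The entries of the (semi-infinite, five-diagonal) CMV matrix. Row `2k` is
`(…, ᾱ_{2k} ρ_{2k-1}, -ᾱ_{2k} α_{2k-1}, ᾱ_{2k+1} ρ_{2k}, ρ_{2k+1} ρ_{2k}, …)` in the columns
`2k-1, …, 2k+2`, and row `2k+1` is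
`(…, ρ_{2k} ρ_{2k-1}, -ρ_{2k} α_{2k-1}, -ᾱ_{2k+1} α_{2k}, -ρ_{2k+1} α_{2k}, …)` in the same
columns; for `k = 0` there is no column `-1`, and `α_{-1} = -1`. -/
def cmvMatrix (α : ℕ → ℂ) : Matrix ℕ ℕ ℂ := fun i j =>
  if Even i then
    if j + 1 = i then conj (cmvA α (i + 1)) * cmvR α i
    else if j = i then -conj (cmvA α (i + 1)) * cmvA α i
    else if j = i + 1 then conj (cmvA α (i + 2)) * cmvR α (i + 1)
    else if j = i + 2 then cmvR α (i + 2) * cmvR α (i + 1)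
    else 0
  else
    if j + 2 = i then cmvR α i * cmvR α (i - 1)
    else if j + 1 = i then -cmvR α i * cmvA α (i - 1)
    else if j = i then -conj (cmvA α (i + 1)) * cmvA α i
    else if j = i + 1 then -cmvR α (i + 1) * cmvA α i
    else 0

/-- The cut-off `𝒞_n`: the top-left `n × n` block of the CMV matrix. -/
def cmvCutoff (α : ℕ → ℂ) (n : ℕ) : Matrix (Fin n) (Fin n) ℂ :=
  (cmvMatrix α).submatrix (fun i => (i : ℕ)) (fun i => (i : ℕ))

/-- The Hilbert space `ℓ²(ℕ₀)`. -/
abbrev Ell2 : Type := lp (fun _ : ℕ => ℂ) 2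

theorem norm_cmvA_le {α : ℕ → ℂ} (h : ∀ n, ‖α n‖ ≤ 1) (n : ℕ) : ‖cmvA α n‖ ≤ 1 := by
  cases n with
  | zero => simp [cmvA]
  | succ n => exact h n

theorem norm_cmvR_le (α : ℕ → ℂ) (n : ℕ) : ‖cmvR α n‖ ≤ 1 := by
  rw [cmvR, Complex.norm_real, Real.norm_of_nonneg (Real.sqrt_nonneg _)]
  exact Real.sqrt_le_iff.2 ⟨zero_le_one, by nlinarith [sq_nonneg ‖cmvA α n‖]⟩

theorem norm_cmvMatrix_le {α : ℕ → ℂ} (h : ∀ n, ‖α n‖ ≤ 1) (i j : ℕ) :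
    ‖cmvMatrix α i j‖ ≤ 1 := by
  have hA := norm_cmvA_le h
  have hR := norm_cmvR_le α
  have key : ∀ {x y : ℝ}, 0 ≤ y → x ≤ 1 → y ≤ 1 → x * y ≤ 1 := fun hy hx hy1 =>
    mul_le_one₀ hx hy hy1
  unfold cmvMatrix
  split_ifs <;> simp only [norm_mul, norm_neg, RCLike.norm_conj, norm_zero, zero_le_one] <;>
    exact key (norm_nonneg _) (by first | exact hA _ | exact hR _)
      (by first | exact hA _ | exact hR _)

theorem cmvMatrix_eq_zero (α : ℕ → ℂ) {i j : ℕ} (h : j + 2 < i ∨ i + 2 < j) :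
    cmvMatrix α i j = 0 := by
  unfold cmvMatrix
  split_ifs <;> first | rfl | omega

/-- The action of the CMV matrix on a sequence (a finite sum, as row `i` vanishes beyond
column `i + 2`). -/
def cmvAct (α : ℕ → ℂ) (x : ℕ → ℂ) (i : ℕ) : ℂ :=
  ∑ j ∈ Finset.range (i + 3), cmvMatrix α i j * x j

/-- Auxiliary: the moduli of `x`, shifted by two places. -/
def shiftTwo (x : ℕ → ℂ) (n : ℕ) : ℝ := if n < 2 then 0 else ‖x (n - 2)‖

theorem norm_cmvAct_le {α : ℕ → ℂ} (h : ∀ n, ‖α n‖ ≤ 1) (x : ℕ → ℂ) (i : ℕ) :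
    ‖cmvAct α x i‖ ≤ ∑ d ∈ Finset.range 5, shiftTwo x (i + d) := by
  have h1 : ‖cmvAct α x i‖ ≤ ∑ j ∈ Finset.range (i + 3), if i ≤ j + 2 then ‖x j‖ else 0 := by
    refine (norm_sum_le _ _).trans (Finset.sum_le_sum fun j _ => ?_)
    split_ifs with hj
    · rw [norm_mul]
      exact mul_le_of_le_one_left (norm_nonneg _) (norm_cmvMatrix_le h i j)
    · rw [cmvMatrix_eq_zero α (Or.inl (by omega))]; simp
  have h2 : ∑ j ∈ Finset.range (i + 3), (if i ≤ j + 2 then ‖x j‖ else 0)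
      ≤ ∑ m ∈ Finset.range (i + 5), if i ≤ m then shiftTwo x m else 0 := by
    rw [Finset.sum_range_succ' (n := i + 4), Finset.sum_range_succ' (n := i + 3)]
    have : ∑ j ∈ Finset.range (i + 3), (if i ≤ j + 2 then ‖x j‖ else 0)
        = ∑ k ∈ Finset.range (i + 3), if i ≤ k + 1 + 1 then shiftTwo x (k + 1 + 1) else 0 := by
      refine Finset.sum_congr rfl fun j _ => ?_
      simp [shiftTwo]
    rw [this]
    have n1 : 0 ≤ (if i ≤ 0 + 1 then shiftTwo x (0 + 1) else 0) := by
      split_ifs <;> simp [shiftTwo]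
    have n2 : 0 ≤ (if i ≤ 0 then shiftTwo x 0 else 0) := by
      split_ifs <;> simp [shiftTwo]
    linarith
  have h3 : ∑ m ∈ Finset.range (i + 5), (if i ≤ m then shiftTwo x m else 0)
      = ∑ d ∈ Finset.range 5, shiftTwo x (i + d) := by
    rw [Finset.sum_range_add]
    have : ∑ m ∈ Finset.range i, (if i ≤ m then shiftTwo x m else 0) = 0 :=
      Finset.sum_eq_zero fun m hm => by
        have := Finset.mem_range.1 hm
        rw [if_neg (by omega)]
    rw [this, zero_add]
    exact Finset.sum_congr rfl fun d _ => by rw [if_pos (by omega)]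
  exact h1.trans (h2.trans h3.le)

theorem summable_sq (x : Ell2) : Summable fun i => ‖x i‖ ^ 2 := by
  have := (memℓp_gen_iff (p := 2) (by norm_num)).1 (lp.memℓp x)
  simpa using this

theorem hasSum_shiftTwo_sq (x : Ell2) : HasSum (fun n => shiftTwo x n ^ 2) (‖x‖ ^ 2) := by
  have h : HasSum (fun n => ‖x n‖ ^ 2) (‖x‖ ^ 2) := by
    have := lp.hasSum_norm (p := 2) (by norm_num) x
    simpa using this
  rw [← hasSum_nat_add_iff' 2]
  simpa [shiftTwo, Finset.sum_range_succ] using h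

theorem sq_cmvAct_le {α : ℕ → ℂ} (h : ∀ n, ‖α n‖ ≤ 1) (x : ℕ → ℂ) (i : ℕ) :
    ‖cmvAct α x i‖ ^ 2 ≤ 5 * ∑ d ∈ Finset.range 5, shiftTwo x (i + d) ^ 2 := by
  have h1 := norm_cmvAct_le h x i
  have h2 : (∑ d ∈ Finset.range 5, shiftTwo x (i + d)) ^ 2
      ≤ 5 * ∑ d ∈ Finset.range 5, shiftTwo x (i + d) ^ 2 := by
    simpa using sq_sum_le_card_mul_sum_sq (s := Finset.range 5)
      (f := fun d => shiftTwo x (i + d))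
  exact (pow_le_pow_left₀ (norm_nonneg _) h1 2).trans h2

theorem summable_shiftTwo_bound (x : Ell2) :
    Summable fun i => 5 * ∑ d ∈ Finset.range 5, shiftTwo x (i + d) ^ 2 :=
  (summable_sum fun d _ =>
    (summable_nat_add_iff d).2 (hasSum_shiftTwo_sq x).summable).mul_left 5

theorem memlp_cmvAct {α : ℕ → ℂ} (h : ∀ n, ‖α n‖ ≤ 1) (x : Ell2) :
    Memℓp (E := fun _ : ℕ => ℂ) (cmvAct α x) 2 := by
  refine memℓp_gen ?_
  simp only [ENNReal.toReal_ofNat, Real.rpow_ofNat]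
  exact (summable_shiftTwo_bound x).of_nonneg_of_le (fun i => by positivity)
    (fun i => sq_cmvAct_le h x i)

theorem norm_cmvAct_lp_le {α : ℕ → ℂ} (h : ∀ n, ‖α n‖ ≤ 1) (x : Ell2) :
    ‖(⟨cmvAct α x, memlp_cmvAct h x⟩ : Ell2)‖ ≤ 5 * ‖x‖ := by
  have hs : HasSum (fun n => ‖cmvAct α x n‖ ^ 2)
      (‖(⟨cmvAct α x, memlp_cmvAct h x⟩ : Ell2)‖ ^ 2) := by
    have := lp.hasSum_norm (p := 2) (by norm_num) (⟨cmvAct α x, memlp_cmvAct h x⟩ : Ell2)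
    simpa using this
  have hb : ∑' i, (5 * ∑ d ∈ Finset.range 5, shiftTwo x (i + d) ^ 2) ≤ 25 * ‖x‖ ^ 2 := by
    have hx := hasSum_shiftTwo_sq x
    rw [tsum_mul_left, Summable.tsum_finsetSum fun d _ => (summable_nat_add_iff d).2 hx.summable]
    have : ∀ d ∈ Finset.range 5, ∑' i, shiftTwo x (i + d) ^ 2 ≤ ‖x‖ ^ 2 := fun d _ => by
      have h1 := hx.summable.sum_add_tsum_nat_add d
      rw [hx.tsum_eq] at h1
      have h2 : 0 ≤ ∑ i ∈ Finset.range d, shiftTwo x i ^ 2 :=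
        Finset.sum_nonneg fun i _ => sq_nonneg _
      linarith
    have h3 := Finset.sum_le_sum this
    simp only [Finset.sum_const, Finset.card_range, nsmul_eq_mul, Nat.cast_ofNat] at h3
    linarith
  have h4 : ‖(⟨cmvAct α x, memlp_cmvAct h x⟩ : Ell2)‖ ^ 2 ≤ (5 * ‖x‖) ^ 2 := by
    have h5 := hasSum_le (fun i => sq_cmvAct_le h x i) hs (summable_shiftTwo_bound x).hasSum
    nlinarith
  exact (pow_le_pow_iff_left₀ (norm_nonneg _) (by positivity) two_ne_zero).1 h4

open Classical in
/-- The CMV operator on `ℓ²(ℕ₀)`: the bounded operator given by the CMV matrix, for coefficients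
in the closed unit disk (and `0` for other sequences, which never occur). -/
def cmvOperator (α : ℕ → ℂ) : Ell2 →L[ℂ] Ell2 :=
  if h : ∀ n, ‖α n‖ ≤ 1 then
    LinearMap.mkContinuous
      { toFun := fun x => ⟨cmvAct α x, memlp_cmvAct h x⟩
        map_add' := fun x y => by
          ext i
          change cmvAct α (x + y : Ell2) i = cmvAct α x i + cmvAct α y i
          simp [cmvAct, mul_add, Finset.sum_add_distrib]
        map_smul' := fun c x => by
          ext i
          change cmvAct α (c • x : Ell2) i = c * cmvAct α x i
          simp [cmvAct, Finset.mul_sum, mul_left_comm] }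
      5 (norm_cmvAct_lp_le h)
  else 0

theorem cmvOperator_apply {α : ℕ → ℂ} (h : ∀ n, ‖α n‖ ≤ 1) (x : Ell2) (i : ℕ) :
    cmvOperator α x i = ∑ j ∈ Finset.range (i + 3), cmvMatrix α i j * x j := by
  simp [cmvOperator, h, cmvAct]

/-! ### Orthogonal and paraorthogonal polynomials -/

/-- The monic OPUC `Φ_n(z) = det(z - 𝒞_n)` with Verblunsky coefficients `α`. -/
def opuc (α : ℕ → ℂ) (n : ℕ) : ℂ[X] := (cmvCutoff α n).charpoly

/-- The reversed polynomial `Φ_n^*(z) = z^n conj(Φ_n(1/z̄))`: the coefficients of `Φ_n`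
(which has degree `n`) are conjugated and their order is reversed. -/
def opucStar (α : ℕ → ℂ) (n : ℕ) : ℂ[X] := ((opuc α n).map (starRingEnd ℂ)).reflect n

/-- The POPUC `Φ_n^{(β)}(z) = det(z - 𝒞_n(α_0, …, α_{n-2}, β))`. -/
def popuc (β : ℂ) (α : ℕ → ℂ) (n : ℕ) : ℂ[X] :=
  (cmvCutoff (Function.update α (n - 1) β) n).charpoly

/-! ### Carathéodory, Schur and `m`-functions -/

/-- The vector `e_0`. -/
def vecE0 : Ell2 := lp.single 2 0 (1 : ℂ)

/-- `m(z) = ⟨e_0, (z - 𝒞)⁻¹ e_0⟩`. -/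
def mFun (α : ℕ → ℂ) (z : ℂ) : ℂ :=
  inner ℂ vecE0 (resolvent (cmvOperator α) z vecE0)

/-- `F(z) = ⟨e_0, (𝒞 + z)(𝒞 - z)⁻¹ e_0⟩`. -/
def caraFun (α : ℕ → ℂ) (z : ℂ) : ℂ :=
  inner ℂ vecE0 (((cmvOperator α + algebraMap ℂ (Ell2 →L[ℂ] Ell2) z) *
    Ring.inverse (cmvOperator α - algebraMap ℂ (Ell2 →L[ℂ] Ell2) z)) vecE0)

open Classical in
/-- `(1/z) (F(z) - 1) / (F(z) + 1)`, with the value `∞` where `F(z) = -1`. -/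
def schurQuot (α : ℕ → ℂ) (z : ℂ) : OnePoint ℂ :=
  if caraFun α z = -1 then OnePoint.infty
  else ((1 / z * ((caraFun α z - 1) / (caraFun α z + 1)) : ℂ) : OnePoint ℂ)

open Classical in
/-- The Schur function, with values in `ℂ ∪ {∞}`: off the spectrum of the CMV operator and for
`z ≠ 0` it is `(1/z) (F(z) - 1) / (F(z) + 1)`; at the other points it is the limit of this
expression, where the limit exists (this concerns `z = 0` and the isolated point masses of the
spectral measure). -/
def schurFun (α : ℕ → ℂ) (z : ℂ) : OnePoint ℂ :=
  if z ∈ resolventSet ℂ (cmvOperator α) \ {0} then schurQuot α z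
  else limUnder (𝓝[resolventSet ℂ (cmvOperator α) \ {0}] z) (schurQuot α)

/-- The value of a point of `ℂ ∪ {∞}` as a complex number (`0` for the point `∞`). -/
def finVal : OnePoint ℂ → ℂ
  | OnePoint.some w => w
  | OnePoint.infty => 0

/-- The reciprocal `1/w` for `w ∈ ℂ ∪ {∞}`, `w ≠ 0`, with `1/∞ = 0`. -/
def recipVal : OnePoint ℂ → ℂ
  | OnePoint.some w => w⁻¹
  | OnePoint.infty => 0

/-- Zeros in the open unit disk. -/
def zeroSet (f : ℂ → OnePoint ℂ) : Set ℂ := {z | ‖z‖ < 1 ∧ f z = ((0 : ℂ) : OnePoint ℂ)}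

/-- Poles outside of the closed unit disk. -/
def poleSet (f : ℂ → OnePoint ℂ) : Set ℂ := {z | 1 < ‖z‖ ∧ f z = OnePoint.infty}

/-! ### Limit points of zeros of POPUC -/

/-- The zeros of `Φ_n^{(β)}` on the unit circle. -/
def popucZeros (β : ℂ) (α : ℕ → ℂ) (n : ℕ) : Set ℂ :=
  {z | ‖z‖ = 1 ∧ (popuc β α n).eval z = 0}

/-- `Λ_{β,t}` for the doubly indexed coefficients `α n N`. -/
def limZeros (α : ℕ → ℕ → ℂ) (β : ℂ) (t : ℝ) : Set ℂ :=
  {z | ‖z‖ = 1 ∧ ∃ n N : ℕ → ℕ, RatioSeq t n N ∧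
    liminf (fun i => Metric.infEDist z (popucZeros β (fun l => α l (N i)) (n i))) atTop = 0}

/-- `Λ_t`, the intersection of all `Λ_{β,t}` with `|β| = 1`. -/
def limZerosAll (α : ℕ → ℕ → ℂ) (t : ℝ) : Set ℂ :=
  {z | ∀ β : ℂ, ‖β‖ = 1 → z ∈ limZeros α β t}

/-! ### The periodic limit matrices -/

/-- The Verblunsky coefficients `-ᾱ_{p-1} β, -ᾱ_{p-2} β, …` of `𝒞_β`, stripped `j` times. -/
def revCoeff (p : ℕ) (a : ℤ → ℂ) (β : ℂ) (j : ℕ) : ℕ → ℂ :=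
  fun n => -conj (a ((p : ℤ) - 1 - ((n + j : ℕ) : ℤ))) * β

/-- `num k N / den k N → L` as `k p / N → t`, uniformly on the compact subsets of `U`; the
denominators have no zeros on the compact set from some index on. -/
def RatioLimit (p : ℕ) (t : ℝ) (num den : ℕ → ℕ → ℂ[X]) (L : ℂ → ℂ) (U : Set ℂ) : Prop :=
  ∀ k N : ℕ → ℕ, RatioSeq t (fun i => k i * p) N → ∀ K ⊆ U, IsCompact K →
    (∀ᶠ i in atTop, ∀ z ∈ K, (den (k i) (N i)).eval z ≠ 0) ∧
    TendstoUniformlyOn (fun i z => (num (k i) (N i)).eval z / (den (k i) (N i)).eval z) L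
      atTop K

end

/-!
The top-left block of the CMV matrix that defines `Φ^{(β)}_{n+1}`, read in the reverse order, is
diagonally conjugate to that of the CMV matrix with coefficients `-ᾱ_{n-1} β, …, -ᾱ_0 β, β`, so the
`(0, 0)` entry of the resolvent of the latter is `Φ_n / Φ^{(β)}_{n+1}`. Continuing the
coefficients by powers of `-ω̄`, where `ω` is a zero of `Φ^{(β)}_{n+1}`, adds only eigenvectors with
eigenvalue `ω`: the unitary operator on `ℓ²` obtained in this way has the zeros of `Φ^{(β)}_{n+1}`
as its spectrum, and `Φ_n / Φ^{(β)}_{n+1}` as its `m`-function. Along `n = kp - j` these operators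
converge strongly to the reversed periodic one, and away from the zeros their resolvents are
bounded; hence the resolvents converge, which is the first limit. The other limits follow from
`Φ^{(β)}_{n+1} = z Φ_n - β̄ Φ*_n`, the Szegő recursion, and the resulting relation between the
`m`-functions for different `β`, all of which come from the same Schur function.
-/

/-! ### The CMV matrix as a product of two pair rotations -/

section PairRotation

variable {E : Type*} [AddCommGroup E] [Module ℂ E] {A R : ℕ → ℂ} {s : ℕ}

/-- The direct sum of the symmetric `2 × 2` blocks `(Ā, R; R, -A)` with parameters `A (n + 1)`,
`R (n + 1)`, acting on the pairs `(v n, v (n + 1))` with `n ≡ s mod 2` of a sequence of vectors.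
For `s = 1` the entry `v 0` belongs to a block whose first row is cut off. -/
def pairRotation (A R : ℕ → ℂ) (s : ℕ) (v : ℕ → E) (n : ℕ) : E :=
  if n % 2 = s then conj (A (n + 1)) • v n + R (n + 1) • v (n + 1)
  else R n • v (n - 1) - A n • v n

/-- The parameters for which the blocks of `pairRotation` are unitary. -/
structure RotationData (A R : ℕ → ℂ) : Prop where
  conj_R : ∀ n, conj (R n) = R n
  sq_add : ∀ n, A n * conj (A n) + R n * R n = 1
  R_zero : R 0 = 0

theorem map_pairRotation {F : Type*} [AddCommGroup F] [Module ℂ F] (f : E →ₗ[ℂ] F) (v : ℕ → E)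
    (n : ℕ) : f (pairRotation A R s v n) = pairRotation A R s (fun m => f (v m)) n := by
  unfold pairRotation
  split_ifs <;> simp only [map_add, map_sub, map_smul]

theorem pairRotation_conj_pairRotation (h : RotationData A R) (hs : s < 2) (v : ℕ → E) (n : ℕ) :
    pairRotation (fun m => conj (A m)) R s (pairRotation A R s v) n = v n := by
  have hn := h.sq_add n
  have hn' := h.sq_add (n + 1)
  by_cases hns : n % 2 = s
  · rw [pairRotation, if_pos hns, pairRotation, pairRotation, if_pos hns, if_neg (by omega),
      Complex.conj_conj, Nat.add_sub_cancel]
    match_scalars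
    · linear_combination hn'
    · ring
  · rcases n with _ | n
    · simp only [pairRotation, if_neg hns, h.R_zero] at hn ⊢
      match_scalars
      linear_combination hn
    · rw [pairRotation, if_neg hns, Nat.add_sub_cancel, pairRotation, pairRotation,
        if_pos (by omega), if_neg hns, Nat.add_sub_cancel]
      match_scalars
      · ring
      · linear_combination hn

theorem pairRotation_mem_span (v : ℕ → E) (n : ℕ) :
    pairRotation A R s v n ∈ Submodule.span ℂ (Set.range v) := by
  have hv (m : ℕ) : v m ∈ Submodule.span ℂ (Set.range v) := Submodule.subset_span ⟨m, rfl⟩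
  unfold pairRotation
  split_ifs
  · exact add_mem (Submodule.smul_mem _ _ (hv _)) (Submodule.smul_mem _ _ (hv _))
  · exact sub_mem (Submodule.smul_mem _ _ (hv _)) (Submodule.smul_mem _ _ (hv _))

theorem span_le_span_pairRotation (h : RotationData A R) (hs : s < 2) (v : ℕ → E) :
    Submodule.span ℂ (Set.range v) ≤ Submodule.span ℂ (Set.range (pairRotation A R s v)) := by
  rw [Submodule.span_le]
  rintro _ ⟨n, rfl⟩
  rw [← pairRotation_conj_pairRotation h hs v n]
  exact pairRotation_mem_span _ n

/-- The matrix of `pairRotation A R s` acting on scalar sequences. -/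
def pairMatrix (A R : ℕ → ℂ) (s i k : ℕ) : ℂ := pairRotation A R s (Pi.single k 1) i

theorem pairMatrix_comm (A R : ℕ → ℂ) (hs : s < 2) (i k : ℕ) :
    pairMatrix A R s i k = pairMatrix A R s k i := by
  simp only [pairMatrix, pairRotation, Pi.single_apply, smul_eq_mul]
  grind

theorem pairRotation_pairMatrix_left (h : RotationData A R) (hs : s < 2) (k n : ℕ) :
    pairRotation (fun m => conj (A m)) R s (fun m => pairMatrix A R s m k) n =
      if n = k then 1 else 0 := by
  simp_rw [pairMatrix, pairRotation_conj_pairRotation h hs, Pi.single_apply]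

end PairRotation

section Orthonormal

variable {E : Type*} [NormedAddCommGroup E] [InnerProductSpace ℂ E] {A R : ℕ → ℂ} {s : ℕ}

theorem inner_pairRotation_right (v : ℕ → E) (x : E) (n : ℕ) :
    inner ℂ x (pairRotation A R s v n) = pairRotation A R s (fun m => inner ℂ x (v m)) n :=
  map_pairRotation (innerₛₗ ℂ x) v n

theorem inner_pairRotation_left (h : RotationData A R) (v : ℕ → E) (x : E) (n : ℕ) :
    inner ℂ (pairRotation A R s v n) x =
      pairRotation (fun m => conj (A m)) R s (fun m => inner ℂ (v m) x) n := by
  unfold pairRotation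
  split_ifs <;> simp only [inner_add_left, inner_sub_left, inner_smul_left, h.conj_R, smul_eq_mul]

theorem pairRotation_orthonormal (h : RotationData A R) (hs : s < 2) {v : ℕ → E}
    (hv : Orthonormal ℂ v) : Orthonormal ℂ (pairRotation A R s v) := by
  rw [orthonormal_iff_ite] at hv ⊢
  intro m n
  have hcol (k : ℕ) : inner ℂ (v k) (pairRotation A R s v n) = pairMatrix A R s k n := by
    rw [inner_pairRotation_right, pairMatrix_comm A R hs, pairMatrix]
    congr 1
    funext l
    rw [hv, Pi.single_apply]
    exact if_congr eq_comm rfl rfl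
  simp_rw [inner_pairRotation_left h, hcol, pairRotation_pairMatrix_left h hs]

end Orthonormal

theorem cmvR_zero (α : ℕ → ℂ) : cmvR α 0 = 0 := by
  simp [cmvR, cmvA]

theorem rotationData_cmv {α : ℕ → ℂ} (h : ∀ n, ‖α n‖ ≤ 1) : RotationData (cmvA α) (cmvR α) where
  conj_R n := by simp [cmvR]
  sq_add n := by
    have hA : ‖cmvA α n‖ ^ 2 ≤ 1 := pow_le_one₀ (norm_nonneg _) (norm_cmvA_le h n)
    rw [Complex.mul_conj, cmvR, ← Complex.ofReal_mul, Real.mul_self_sqrt (by linarith),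
      Complex.normSq_eq_norm_sq]
    push_cast; ring
  R_zero := cmvR_zero α

theorem cmvMatrix_eq_pairRotation (α : ℕ → ℂ) (i j : ℕ) :
    cmvMatrix α i j = pairRotation (cmvA α) (cmvR α) 1
      (fun k => pairMatrix (cmvA α) (cmvR α) 0 k i) j := by
  have hR := cmvR_zero α
  simp only [cmvMatrix, pairMatrix, pairRotation, Pi.single_apply, smul_eq_mul, Nat.even_iff]
  grind

/-! ### Unitarity and strong convergence of CMV operators -/

/-- The standard basis of `ℓ²(ℕ₀)`. -/
noncomputable def ell2Basis : HilbertBasis ℕ ℂ Ell2 := .ofRepr (.refl ℂ Ell2)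

theorem ell2Basis_apply (i : ℕ) : ell2Basis i = lp.single 2 i (1 : ℂ) := by
  rw [← ell2Basis.repr_symm_single i]
  rfl

theorem ell2Basis_coord (i j : ℕ) : (ell2Basis i : Ell2) j = if j = i then 1 else 0 := by
  rw [ell2Basis_apply, lp.single_apply, Pi.single_apply]

theorem dense_span_ell2Basis : Dense (Submodule.span ℂ (Set.range ell2Basis) : Set Ell2) :=
  Submodule.dense_iff_topologicalClosure_eq_top.2 ell2Basis.dense_span

theorem cmvOperator_basis_apply {α : ℕ → ℂ} (h : ∀ n, ‖α n‖ ≤ 1) (j i : ℕ) :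
    cmvOperator α (ell2Basis j) i = cmvMatrix α i j := by
  rw [cmvOperator_apply h]
  simp only [ell2Basis_coord, mul_ite, mul_one, mul_zero, Finset.sum_ite_eq', Finset.mem_range]
  split_ifs with hj
  · rfl
  · rw [cmvMatrix_eq_zero]; omega

theorem cmvOperator_basis {α : ℕ → ℂ} (h : ∀ n, ‖α n‖ ≤ 1) (j : ℕ) :
    cmvOperator α (ell2Basis j) = pairRotation (cmvA α) (cmvR α) 1
      (pairRotation (cmvA α) (cmvR α) 0 ell2Basis) j := by
  ext i
  have hcoord (A R : ℕ → ℂ) (s n : ℕ) (v : ℕ → Ell2) :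
      pairRotation A R s v n i = pairRotation A R s (fun m => v m i) n :=
    map_pairRotation (lp.evalₗ (𝕜 := ℂ) (fun _ : ℕ => ℂ) 2 i) v n
  rw [cmvOperator_basis_apply h, cmvMatrix_eq_pairRotation, hcoord]
  simp only [hcoord, pairMatrix, ell2Basis_coord]
  congr! with k l
  rw [Pi.single_apply]
  exact if_congr eq_comm rfl rfl

theorem exists_linearIsometryEquiv_eq_cmvOperator {α : ℕ → ℂ} (h : ∀ n, ‖α n‖ ≤ 1) :
    ∃ e : Ell2 ≃ₗᵢ[ℂ] Ell2, cmvOperator α = (e : Ell2 →L[ℂ] Ell2) := by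
  have hd := rotationData_cmv h
  have ho := pairRotation_orthonormal hd one_lt_two
    (pairRotation_orthonormal hd zero_lt_two ell2Basis.orthonormal)
  have hs := ell2Basis.dense_span.ge.trans (Submodule.topologicalClosure_mono
    ((span_le_span_pairRotation hd zero_lt_two ell2Basis).trans
      (span_le_span_pairRotation hd one_lt_two _)))
  refine ⟨(HilbertBasis.mk ho hs).repr.symm, ContinuousLinearMap.ext_on dense_span_ell2Basis ?_⟩
  rintro _ ⟨j, rfl⟩
  rw [cmvOperator_basis h, ell2Basis_apply]
  exact ((HilbertBasis.repr_symm_single _ j).trans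
    (congrFun (HilbertBasis.coe_mk ho hs) j)).symm

theorem norm_cmvOperator_apply {α : ℕ → ℂ} (h : ∀ n, ‖α n‖ ≤ 1) (x : Ell2) :
    ‖cmvOperator α x‖ = ‖x‖ := by
  obtain ⟨e, he⟩ := exists_linearIsometryEquiv_eq_cmvOperator h
  rw [he]
  exact e.norm_map x

theorem cmvOperator_mem_unitary {α : ℕ → ℂ} (h : ∀ n, ‖α n‖ ≤ 1) :
    cmvOperator α ∈ unitary (Ell2 →L[ℂ] Ell2) := by
  obtain ⟨e, he⟩ := exists_linearIsometryEquiv_eq_cmvOperator h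
  rw [he]
  exact (Unitary.linearIsometryEquiv.symm e).2

section StrongConvergence

variable {ι : Type*} {l : Filter ι}

theorem tendsto_pairRotation {E : Type*} [NormedAddCommGroup E] [NormedSpace ℂ E]
    {A R : ι → ℕ → ℂ} {A' R' : ℕ → ℂ} {v : ι → ℕ → E} {v' : ℕ → E}
    (hA : ∀ n, Tendsto (fun i => A i n) l (𝓝 (A' n)))
    (hR : ∀ n, Tendsto (fun i => R i n) l (𝓝 (R' n)))
    (hv : ∀ n, Tendsto (fun i => v i n) l (𝓝 (v' n))) (s n : ℕ) :
    Tendsto (fun i => pairRotation (A i) (R i) s (v i) n) l (𝓝 (pairRotation A' R' s v' n)) := by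
  unfold pairRotation
  split_ifs
  · exact (((Complex.continuous_conj.tendsto _).comp (hA _)).smul (hv _)).add ((hR _).smul (hv _))
  · exact ((hR _).smul (hv _)).sub ((hA _).smul (hv _))

theorem tendsto_apply_of_norm_le_of_dense_span {𝕜 E F : Type*} [NontriviallyNormedField 𝕜]
    [NormedAddCommGroup E] [NormedSpace 𝕜 E] [NormedAddCommGroup F] [NormedSpace 𝕜 F]
    {T : ι → E →L[𝕜] F} {T' : E →L[𝕜] F} {C : ℝ} (hT : ∀ i, ‖T i‖ ≤ C) {v : Set E}
    (hv : Dense (Submodule.span 𝕜 v : Set E))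
    (hlim : ∀ y ∈ v, Tendsto (fun i => T i y) l (𝓝 (T' y))) (x : E) :
    Tendsto (fun i => T i x) l (𝓝 (T' x)) := by
  have hequi : Equicontinuous fun i => (T i : E → F) :=
    (LipschitzWith.uniformEquicontinuous (fun i => (T i : E → F)) C.toNNReal fun i =>
      (T i).lipschitz.weaken <| by
        rw [← norm_toNNReal]
        exact Real.toNNReal_le_toNNReal (hT i)).equicontinuous
  have hclosed := hequi.isClosed_setOfPred_tendsto (l := l) T'.continuous
  have hspan : (Submodule.span 𝕜 v : Set E) ⊆ {y | Tendsto (fun i => T i y) l (𝓝 (T' y))} := by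
    intro y hy
    induction hy using Submodule.span_induction with
    | mem y hy => exact hlim y hy
    | zero => simpa only [Set.mem_ofPred_eq, map_zero] using tendsto_const_nhds
    | add y z _ _ hy hz => simpa only [Set.mem_ofPred_eq, map_add] using hy.add hz
    | smul c y _ hy => simpa only [Set.mem_ofPred_eq, map_smul] using hy.const_smul c
  exact hclosed.closure_subset_iff.2 hspan (hv x)

theorem tendsto_cmvOperator_apply {γ : ι → ℕ → ℂ} {γ' : ℕ → ℂ}
    (h : ∀ i n, ‖γ i n‖ ≤ 1) (h' : ∀ n, ‖γ' n‖ ≤ 1)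
    (hlim : ∀ n, Tendsto (fun i => γ i n) l (𝓝 (γ' n))) (x : Ell2) :
    Tendsto (fun i => cmvOperator (γ i) x) l (𝓝 (cmvOperator γ' x)) := by
  have hA (n : ℕ) : Tendsto (fun i => cmvA (γ i) n) l (𝓝 (cmvA γ' n)) := by
    cases n with
    | zero => exact tendsto_const_nhds
    | succ n => exact hlim n
  have hR (n : ℕ) : Tendsto (fun i => cmvR (γ i) n) l (𝓝 (cmvR γ' n)) :=
    (Complex.continuous_ofReal.tendsto _).comp ((Real.continuous_sqrt.tendsto _).comp
      (((hA n).norm.pow 2).const_sub 1))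
  refine tendsto_apply_of_norm_le_of_dense_span (C := 1)
    (fun i => ContinuousLinearMap.opNorm_le_bound _ zero_le_one fun y => ?_)
    dense_span_ell2Basis ?_ x
  · rw [norm_cmvOperator_apply (h i), one_mul]
  · rintro _ ⟨n, rfl⟩
    have h0 (m : ℕ) : Tendsto
        (fun i => pairRotation (cmvA (γ i)) (cmvR (γ i)) 0 ell2Basis m) l
        (𝓝 (pairRotation (cmvA γ') (cmvR γ') 0 ell2Basis m)) :=
      tendsto_pairRotation hA hR (v := fun _ => ell2Basis) (fun _ => tendsto_const_nhds) 0 m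
    rw [cmvOperator_basis h']
    exact (tendsto_pairRotation hA hR h0 1 n).congr fun i => (cmvOperator_basis (h i) n).symm

end StrongConvergence

/-! ### Resolvents of normal and unitary operators -/

section Algebra

variable {A : Type*} [Ring A] [Algebra ℂ A]

theorem mem_resolventSet_of_le_norm_sub_spectrum {a : A} {z : ℂ} {δ : ℝ} (hδ : 0 < δ)
    (h : ∀ w ∈ spectrum ℂ a, δ ≤ ‖z - w‖) : z ∈ resolventSet ℂ a := by
  by_contra hz
  have hzz := h z hz
  rw [sub_self, norm_zero] at hzz
  exact hδ.not_ge hzz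

theorem star_resolvent_inv_conj [StarRing A] [StarModule ℂ A] {U : A}
    (hU : U ∈ unitary A) {z : ℂ} (hz : z ∈ resolventSet ℂ U) (hz0 : z ≠ 0) :
    star (resolvent U (conj z)⁻¹) = z • (1 - z • resolvent U z) := by
  set R := resolvent U z
  have hRl : U * R = z • R - 1 := by
    have : (algebraMap ℂ A z - U) * R = 1 := Ring.mul_inverse_cancel _ hz
    rw [sub_mul, Algebra.algebraMap_eq_smul_one, smul_mul_assoc, one_mul] at this
    rw [← this, sub_sub_cancel]
  have hRr : R * U = z • R - 1 := by
    have : R * (algebraMap ℂ A z - U) = 1 := Ring.inverse_mul_cancel _ hz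
    rw [mul_sub, Algebra.algebraMap_eq_smul_one, mul_smul_comm, mul_one] at this
    rw [← this, sub_sub_cancel]
  have hl : (algebraMap ℂ A z⁻¹ - star U) * (z • (1 - z • R)) = 1 := by
    rw [← neg_sub (z • R), ← hRl, Algebra.algebraMap_eq_smul_one, sub_mul, smul_mul_assoc, one_mul,
      inv_smul_smul₀ hz0, mul_smul_comm, mul_neg, ← mul_assoc, Unitary.star_mul_self_of_mem hU,
      one_mul, hRl]
    module
  have hr : (z • (1 - z • R)) * (algebraMap ℂ A z⁻¹ - star U) = 1 := by
    rw [← neg_sub (z • R), ← hRr, Algebra.algebraMap_eq_smul_one, mul_sub, mul_smul_comm, mul_one,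
      inv_smul_smul₀ hz0, smul_mul_assoc, neg_mul, mul_assoc, Unitary.mul_star_self_of_mem hU,
      mul_one, hRr]
    module
  have hstar : star (algebraMap ℂ A (conj z)⁻¹ - U) = algebraMap ℂ A z⁻¹ - star U := by
    rw [star_sub, ← algebraMap_star_comm, ← map_inv₀]
    exact congrArg (algebraMap ℂ A · - star U) (Complex.conj_conj z⁻¹)
  rw [resolvent, ← Ring.inverse_star, hstar]
  exact Ring.inverse_unit ⟨_, _, hl, hr⟩

end Algebra

theorem norm_resolvent_le {A : Type*} [CStarAlgebra A] {a : A} (ha : IsStarNormal a)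
    {z : ℂ} {δ : ℝ} (hδ : 0 < δ) (h : ∀ w ∈ spectrum ℂ a, δ ≤ ‖z - w‖) :
    ‖resolvent a z‖ ≤ δ⁻¹ := by
  have hne : ∀ w ∈ spectrum ℂ a, z - w ≠ 0 := fun w hw =>
    norm_pos_iff.1 (hδ.trans_le (h w hw))
  have hcfc : resolvent a z = cfc (fun w => (z - w)⁻¹) a := by
    rw [cfc_inv _ a hne, cfc_sub (fun _ => z) (fun w => w) a, cfc_const z a, cfc_id' ℂ a, resolvent]
  rw [hcfc]
  refine norm_cfc_le (inv_nonneg.2 hδ.le) fun w hw => ?_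
  rw [norm_inv]
  exact inv_anti₀ hδ (h w hw)

section Resolvent

variable {H : Type*} [NormedAddCommGroup H] [InnerProductSpace ℂ H]

theorem sub_apply_resolvent {T : H →L[ℂ] H} {z : ℂ} (hz : z ∈ resolventSet ℂ T) (x : H) :
    z • resolvent T z x - T (resolvent T z x) = x := by
  have := DFunLike.congr_fun (Ring.mul_inverse_cancel _ hz) x
  simpa [resolvent, Algebra.algebraMap_eq_smul_one] using this

theorem resolvent_sub_apply {T : H →L[ℂ] H} {z : ℂ} (hz : z ∈ resolventSet ℂ T) (x : H) :
    resolvent T z (z • x - T x) = x := by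
  have := DFunLike.congr_fun (Ring.inverse_mul_cancel _ hz) x
  simpa [resolvent, Algebra.algebraMap_eq_smul_one] using this

theorem two_mul_re_mul_inner_resolvent {T : H →L[ℂ] H} (hT : ∀ x, ‖T x‖ = ‖x‖) {z : ℂ}
    (hz : z ∈ resolventSet ℂ T) (e : H) :
    2 * (z * inner ℂ e (resolvent T z e)).re
      = ‖e‖ ^ 2 + (‖z‖ ^ 2 - 1) * ‖resolvent T z e‖ ^ 2 := by
  set x := resolvent T z e
  have hTx : z • x - e = T x := by
    rw [sub_eq_iff_eq_add', ← sub_eq_iff_eq_add, sub_apply_resolvent hz]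
  have hnorm : ‖z • x - e‖ ^ 2 = ‖x‖ ^ 2 := by rw [hTx, hT]
  have hinner : RCLike.re (inner ℂ (z • x) e) = (z * inner ℂ e x).re := by
    rw [← inner_conj_symm, inner_smul_right, RCLike.conj_re]
    rfl
  rw [@norm_sub_sq ℂ, norm_smul, mul_pow, hinner] at hnorm
  linarith

variable [CompleteSpace H]

theorem le_norm_smul_sub_apply {T : H →L[ℂ] H} (hT : IsStarNormal T) {z : ℂ} {δ : ℝ} (hδ : 0 < δ)
    (h : ∀ w ∈ spectrum ℂ T, δ ≤ ‖z - w‖) (x : H) : δ * ‖x‖ ≤ ‖z • x - T x‖ := by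
  have hR : ‖resolvent T z‖ ≤ δ⁻¹ := norm_resolvent_le hT hδ h
  have hx := (resolvent T z).le_of_opNorm_le hR (z • x - T x)
  rwa [resolvent_sub_apply (mem_resolventSet_of_le_norm_sub_spectrum hδ h), inv_mul_eq_div,
    le_div_iff₀ hδ, mul_comm] at hx

theorem mem_resolventSet_of_forall_le_norm {T : H →L[ℂ] H} (hT : IsStarNormal T) {z : ℂ} {δ : ℝ}
    (hδ : 0 < δ) (h : ∀ x, δ * ‖x‖ ≤ ‖z • x - T x‖) : z ∈ resolventSet ℂ T := by
  have hN : IsStarNormal (algebraMap ℂ (H →L[ℂ] H) z - T) := by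
    rw [← cfc_id' ℂ T, ← cfc_const z T, ← cfc_sub (fun _ => z) (fun w => w) T]
    exact cfc_predicate _ T
  have hle (x : H) : δ * ‖x‖ ≤ ‖(algebraMap ℂ (H →L[ℂ] H) z - T) x‖ := by
    simpa [Algebra.algebraMap_eq_smul_one] using h x
  rw [spectrum.mem_resolventSet_iff, ContinuousLinearMap.isUnit_iff_bijective,
    ContinuousLinearMap.bijective_iff_dense_range_and_antilipschitz]
  refine ⟨?_, (Real.toNNReal δ)⁻¹, ?_⟩
  · rw [Submodule.topologicalClosure_eq_top_iff,
      ContinuousLinearMap.IsStarNormal.orthogonal_range hN, Submodule.eq_bot_iff]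
    intro x hx
    have hx0 := hle x
    rw [show (algebraMap ℂ (H →L[ℂ] H) z - T) x = 0 from hx, norm_zero] at hx0
    exact norm_le_zero_iff.1 (by nlinarith [norm_nonneg x])
  · refine ContinuousLinearMap.antilipschitz_of_bound _ fun x => ?_
    rw [NNReal.coe_inv, Real.coe_toNNReal _ hδ.le, inv_mul_eq_div, le_div_iff₀ hδ, mul_comm]
    exact hle x

variable {ι : Type*} {l : Filter ι} {T : ι → H →L[ℂ] H} {T' : H →L[ℂ] H} {z : ℂ} {δ : ℝ}

theorem mem_resolventSet_of_tendsto [l.NeBot] (hT : ∀ i, IsStarNormal (T i))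
    (hT' : IsStarNormal T') (hlim : ∀ x, Tendsto (fun i => T i x) l (𝓝 (T' x))) (hδ : 0 < δ)
    (h : ∀ᶠ i in l, ∀ w ∈ spectrum ℂ (T i), δ ≤ ‖z - w‖) : z ∈ resolventSet ℂ T' := by
  refine mem_resolventSet_of_forall_le_norm hT' hδ fun x => ?_
  refine ge_of_tendsto ((hlim x).const_sub (z • x)).norm ?_
  filter_upwards [h] with i hi
  exact le_norm_smul_sub_apply (hT i) hδ hi x

theorem tendsto_resolvent_apply (hT : ∀ i, IsStarNormal (T i)) (hz : z ∈ resolventSet ℂ T')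
    (hlim : ∀ x, Tendsto (fun i => T i x) l (𝓝 (T' x))) (hδ : 0 < δ)
    (h : ∀ᶠ i in l, ∀ w ∈ spectrum ℂ (T i), δ ≤ ‖z - w‖) (e : H) :
    Tendsto (fun q : ι × ℂ => resolvent (T q.1) q.2 e) (l ×ˢ 𝓝 z) (𝓝 (resolvent T' z e)) := by
  set x := resolvent T' z e
  have hx : z • x - T' x = e := sub_apply_resolvent hz e
  have hdist : ∀ᶠ q : ι × ℂ in l ×ˢ 𝓝 z, ∀ v ∈ spectrum ℂ (T q.1), δ / 2 ≤ ‖q.2 - v‖ := by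
    filter_upwards [h.prod_mk (Metric.ball_mem_nhds z (half_pos hδ))] with q hq v hv
    have hzv := hq.1 v hv
    have hqz : ‖z - q.2‖ < δ / 2 := by rw [← dist_eq_norm, dist_comm]; exact hq.2
    linarith [norm_sub_le_norm_sub_add_norm_sub z q.2 v]
  have hdiff : Tendsto (fun q : ι × ℂ => e - (q.2 • x - T q.1 x)) (l ×ˢ 𝓝 z) (𝓝 0) := by
    have := (((tendsto_snd (f := l) (g := 𝓝 z)).smul_const x).sub
      ((hlim x).comp tendsto_fst)).const_sub e
    rwa [hx, sub_self] at this
  rw [tendsto_iff_norm_sub_tendsto_zero]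
  refine squeeze_zero' (Eventually.of_forall fun _ => norm_nonneg _) ?_
    (by simpa only [norm_zero, mul_zero] using hdiff.norm.const_mul (δ / 2)⁻¹)
  filter_upwards [hdist] with q hq
  have hsub : resolvent (T q.1) q.2 e - x = resolvent (T q.1) q.2 (e - (q.2 • x - T q.1 x)) := by
    rw [map_sub, resolvent_sub_apply (mem_resolventSet_of_le_norm_sub_spectrum (half_pos hδ) hq)]
  rw [hsub]
  have hR : ‖resolvent (T q.1) q.2‖ ≤ (δ / 2)⁻¹ := norm_resolvent_le (hT q.1) (half_pos hδ) hq
  exact ContinuousLinearMap.le_of_opNorm_le _ hR _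

end Resolvent

/-! ### The Szegő recursion -/

section PairCutoff

variable {A R A' R' : ℕ → ℂ} {s n : ℕ}

/-- The top-left `n × n` block of `pairMatrix A R s`. -/
noncomputable def pairCutoff (A R : ℕ → ℂ) (s n : ℕ) : Matrix (Fin n) (Fin n) ℂ :=
  Matrix.of fun i k => pairMatrix A R s i k

theorem pairMatrix_apply (A R : ℕ → ℂ) (s i k : ℕ) : pairMatrix A R s i k =
    if i % 2 = s then (if i = k then conj (A (i + 1)) else 0) + if i + 1 = k then R (i + 1) else 0
    else (if i - 1 = k then R i else 0) - if i = k then A i else 0 := by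
  simp only [pairMatrix, pairRotation, Pi.single_apply, smul_eq_mul, mul_ite, mul_one, mul_zero]

theorem sum_pairMatrix_mul (A R : ℕ → ℂ) (s n i : ℕ) (f : ℕ → ℂ) :
    ∑ k : Fin n, pairMatrix A R s i k * f k =
      pairRotation A R s (fun l => if l < n then f l else 0) i := by
  rw [← Finset.sum_range fun k => pairMatrix A R s i k * f k]
  simp only [pairMatrix_apply, pairRotation, smul_eq_mul]
  split_ifs <;>
    simp only [add_mul, sub_mul, ite_mul, zero_mul, Finset.sum_add_distrib,
      Finset.sum_sub_distrib, Finset.sum_ite_eq, Finset.mem_range, mul_zero] <;>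
    grind

theorem pairRotation_congr {E : Type*} [AddCommGroup E] [Module ℂ E] {v w : ℕ → E}
    (hn : n % 2 = s) (hvw : ∀ l < n, v l = w l) {i : ℕ} (hi : i < n) :
    pairRotation A R s v i = pairRotation A R s w i := by
  unfold pairRotation
  split_ifs with his
  · rw [hvw i hi, hvw (i + 1) (by omega)]
  · rw [hvw i hi, hvw (i - 1) (by omega)]

theorem conj_pairMatrix (h : RotationData A R) (i k : ℕ) :
    conj (pairMatrix A R s i k) = pairMatrix (fun n => conj (A n)) R s i k := by
  simp only [pairMatrix_apply]
  split_ifs <;> simp [h.conj_R]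

theorem conj_pairCutoff_mul_self (h : RotationData A R) (hn : n % 2 = s) :
    (pairCutoff A R s n).map (starRingEnd ℂ) * pairCutoff A R s n = 1 := by
  ext i j
  have hs : s < 2 := by omega
  simp only [Matrix.mul_apply, Matrix.map_apply, pairCutoff, Matrix.of_apply, conj_pairMatrix h]
  rw [sum_pairMatrix_mul _ R s n i fun l => pairMatrix A R s l j,
    pairRotation_congr hn (fun l hl => if_pos hl) i.2, pairRotation_pairMatrix_left h hs,
    Matrix.one_apply]
  exact if_congr Fin.ext_iff.symm rfl rfl

theorem pairCutoff_congr (hA : ∀ m ≤ n, A m = A' m) (hR : ∀ m ≤ n, R m = R' m) :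
    pairCutoff A R s n = pairCutoff A' R' s n := by
  ext i k
  simp only [pairCutoff, Matrix.of_apply, pairMatrix_apply]
  rw [hA (i + 1) i.2, hA i i.2.le, hR (i + 1) i.2, hR i i.2.le]

theorem pairCutoff_succ (A R : ℕ → ℂ) (hn : n % 2 = s) :
    (pairCutoff A R s (n + 1)).submatrix finSumFinEquiv finSumFinEquiv =
      Matrix.fromBlocks (pairCutoff A R s n) 0 0 (Matrix.of fun _ _ => conj (A (n + 1))) := by
  ext (i | i) (j | j) <;>
    simp only [Matrix.submatrix_apply, pairCutoff, Matrix.of_apply, pairMatrix_apply,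
      finSumFinEquiv_apply_left, finSumFinEquiv_apply_right, Matrix.fromBlocks_apply₁₁,
      Matrix.fromBlocks_apply₁₂, Matrix.fromBlocks_apply₂₁, Matrix.fromBlocks_apply₂₂,
      Fin.val_castAdd, Fin.val_natAdd, Matrix.zero_apply] <;>
    grind

theorem pairCutoff_add_two (A R : ℕ → ℂ) (hn : n % 2 = s) :
    (pairCutoff A R s (n + 2)).submatrix finSumFinEquiv finSumFinEquiv =
      Matrix.fromBlocks (pairCutoff A R s n) 0 0
        !![conj (A (n + 1)), R (n + 1); R (n + 1), -A (n + 1)] := by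
  ext (i | i) (j | j) <;>
    simp only [Matrix.submatrix_apply, pairCutoff, Matrix.of_apply, pairMatrix_apply,
      finSumFinEquiv_apply_left, finSumFinEquiv_apply_right, Matrix.fromBlocks_apply₁₁,
      Matrix.fromBlocks_apply₁₂, Matrix.fromBlocks_apply₂₁, Matrix.fromBlocks_apply₂₂,
      Fin.val_castAdd, Fin.val_natAdd, Matrix.zero_apply]
  · grind
  · grind
  · fin_cases i <;> fin_cases j <;> simp <;> grind

theorem neg_one_pow_mul_det_pairCutoff (h : RotationData A R) (hA : A 0 = -1) (n : ℕ) :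
    (-1) ^ n * (pairCutoff A R (n % 2) n).det * (pairCutoff A R ((n + 1) % 2) (n + 1)).det = 1 := by
  induction n with
  | zero => simp [pairCutoff, pairMatrix_apply, hA, h.R_zero]
  | succ n ih =>
    have hdet : (pairCutoff A R (n % 2) (n + 2)).det = -(pairCutoff A R (n % 2) n).det := by
      rw [← Matrix.det_submatrix_equiv_self finSumFinEquiv, pairCutoff_add_two A R rfl,
        Matrix.det_fromBlocks_zero₂₁, Matrix.det_fin_two_of]
      linear_combination -(pairCutoff A R (n % 2) n).det * h.sq_add (n + 1)
    rw [show (n + 1 + 1) % 2 = n % 2 by omega, hdet, pow_succ]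
    linear_combination ih

end PairCutoff

section Determinants

variable {m S : Type*} [Fintype m] [DecidableEq m] [CommRing S]

theorem det_sub_fromBlocks_corner (M : Matrix (m ⊕ Fin 1) (m ⊕ Fin 1) S) (w : S) :
    (M - Matrix.fromBlocks 0 0 0 (Matrix.of fun _ _ => w)).det =
      M.det - w * M.toBlocks₁₁.det := by
  have hrow : M - Matrix.fromBlocks 0 0 0 (Matrix.of fun _ _ => w) =
      M.updateRow (Sum.inr 0) (M (Sum.inr 0) + (-w) • Pi.single (Sum.inr 0) 1) := by
    ext (i | i) (j | j) <;>
      simp [Matrix.updateRow_apply, Fin.fin_one_eq_zero, sub_eq_add_neg]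
  have hcorner : M.updateRow (Sum.inr 0) (Pi.single (Sum.inr 0) 1) =
      Matrix.fromBlocks M.toBlocks₁₁ M.toBlocks₁₂ 0 1 := by
    ext (i | i) (j | j) <;>
      simp [Matrix.updateRow_apply, Fin.fin_one_eq_zero, Matrix.toBlocks₁₁,
        Matrix.toBlocks₁₂]
  rw [hrow, Matrix.det_updateRow_add, Matrix.det_updateRow_smul, Matrix.updateRow_eq_self, hcorner,
    Matrix.det_fromBlocks_zero₂₁, Matrix.det_one]
  ring

theorem det_smul_one_sub_fromBlocks_mul (z w : S) {P P' : Matrix m m S} (hP : P' * P = 1)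
    {B B' : Matrix (m ⊕ Fin 1) (m ⊕ Fin 1) S} (hB : B' * B = 1) :
    (z • 1 - Matrix.fromBlocks P 0 0 (Matrix.of fun _ _ => w) * B).det =
      z * (z • 1 - P * B.toBlocks₁₁).det
        - w * ((-1) ^ Fintype.card m * P.det * B.det * (1 - z • (B'.toBlocks₁₁ * P')).det) := by
  have hfactor (K : Matrix (m ⊕ Fin 1) (m ⊕ Fin 1) S) : (z • 1 - K * B) = (z • B' - K) * B := by
    rw [sub_mul, smul_mul_assoc, hB]
  have hsplit : z • B' - Matrix.fromBlocks P 0 0 (Matrix.of fun _ _ => w) =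
      (z • B' - Matrix.fromBlocks P 0 0 0) -
        Matrix.fromBlocks 0 0 0 (Matrix.of fun _ _ => w) := by
    rw [sub_sub, Matrix.fromBlocks_add]
    simp only [add_zero, zero_add]
  have hupper : (z • 1 - Matrix.fromBlocks P 0 0 0 * B).det =
      z * (z • 1 - P * B.toBlocks₁₁).det := by
    conv_lhs => rw [← Matrix.fromBlocks_toBlocks B, ← Matrix.fromBlocks_one,
      Matrix.fromBlocks_multiply, Matrix.fromBlocks_smul, sub_eq_add_neg, Matrix.fromBlocks_neg,
      Matrix.fromBlocks_add]
    simp only [Matrix.zero_mul, add_zero, smul_zero, neg_zero, ← sub_eq_add_neg,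
      Matrix.det_fromBlocks_zero₂₁, Matrix.det_smul, Matrix.det_one, Fintype.card_fin, pow_one]
    ring
  have hlower : (z • B' - Matrix.fromBlocks P 0 0 0).toBlocks₁₁ =
      -((1 - z • (B'.toBlocks₁₁ * P')) * P) := by
    rw [sub_mul, smul_mul_assoc, mul_assoc, hP, mul_one, one_mul, neg_sub]
    rfl
  rw [hfactor, hsplit, Matrix.det_mul, det_sub_fromBlocks_corner, sub_mul, ← Matrix.det_mul,
    ← hfactor, hupper, hlower, Matrix.det_neg, Matrix.det_mul]
  ring

theorem eval_charpoly_eq_det (M : Matrix m m S) (z : S) :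
    M.charpoly.eval z = (z • 1 - M).det := by
  rw [Matrix.eval_charpoly, Matrix.scalar_apply, Matrix.smul_one_eq_diagonal]

theorem eval_charpolyRev_eq_det (M : Matrix m m S) (z : S) :
    M.charpolyRev.eval z = (1 - z • M).det := by
  rw [Matrix.charpolyRev, ← Polynomial.coe_evalRingHom, RingHom.map_det]
  congr 1
  ext i j
  by_cases hij : i = j <;> simp [hij, mul_comm z]

end Determinants

theorem cmvCutoff_eq_mul (α : ℕ → ℂ) (n : ℕ) :
    cmvCutoff α n = pairCutoff (cmvA α) (cmvR α) 0 n * pairCutoff (cmvA α) (cmvR α) 1 n := by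
  ext i j
  have hprod : (pairCutoff (cmvA α) (cmvR α) 0 n * pairCutoff (cmvA α) (cmvR α) 1 n) i j
      = ∑ k : Fin n, pairMatrix (cmvA α) (cmvR α) 1 j k * pairMatrix (cmvA α) (cmvR α) 0 k i := by
    rw [Matrix.mul_apply]
    refine Finset.sum_congr rfl fun k _ => ?_
    rw [mul_comm, pairMatrix_comm _ _ one_lt_two, pairMatrix_comm _ _ zero_lt_two]
    rfl
  rw [hprod, sum_pairMatrix_mul _ _ 1 n j fun k => pairMatrix (cmvA α) (cmvR α) 0 k i]
  change cmvMatrix α i j = _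
  rw [cmvMatrix_eq_pairRotation]
  -- row `n` of the even factor vanishes in the columns `< n` whenever it is reached
  have hrow : n % 2 = 0 → pairMatrix (cmvA α) (cmvR α) 0 n i = 0 := fun hn => by
    rw [pairMatrix_apply, if_pos hn, if_neg (by omega), if_neg (by omega), add_zero]
  unfold pairRotation
  grind

theorem opuc_eq_charpoly_mul (α : ℕ → ℂ) (n m : ℕ) :
    opuc α n = (pairCutoff (cmvA α) (cmvR α) (m % 2) n
      * pairCutoff (cmvA α) (cmvR α) ((m + 1) % 2) n).charpoly := by
  rw [opuc, cmvCutoff_eq_mul]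
  rcases Nat.mod_two_eq_zero_or_one m with hm | hm
  · rw [hm, show (m + 1) % 2 = 1 by omega]
  · rw [hm, show (m + 1) % 2 = 0 by omega, Matrix.charpoly_mul_comm]

theorem natDegree_opuc (α : ℕ → ℂ) (n : ℕ) : (opuc α n).natDegree = n := by
  rw [opuc, Matrix.charpoly_natDegree_eq_dim, Fintype.card_fin]

theorem opucStar_eq_charpolyRev (α : ℕ → ℂ) (n m : ℕ) :
    opucStar α n = ((pairCutoff (cmvA α) (cmvR α) (m % 2) n
      * pairCutoff (cmvA α) (cmvR α) ((m + 1) % 2) n).map (starRingEnd ℂ)).charpolyRev := by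
  rw [← Matrix.reverse_charpoly, Matrix.charpoly_map, ← opuc_eq_charpoly_mul, opucStar,
    Polynomial.reverse, Polynomial.natDegree_map, natDegree_opuc]

theorem opuc_succ {α : ℕ → ℂ} (h : ∀ n, ‖α n‖ ≤ 1) (n : ℕ) :
    opuc α (n + 1) = X * opuc α n - C (conj (α n)) * opucStar α n := by
  have hd := rotationData_cmv h
  refine Polynomial.funext fun z => ?_
  set P := pairCutoff (cmvA α) (cmvR α) (n % 2) n
  set B := pairCutoff (cmvA α) (cmvR α) ((n + 1) % 2) (n + 1)
  let e : Fin n ⊕ Fin 1 ≃ Fin (n + 1) := finSumFinEquiv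
  have hB : (B.submatrix e e).map (starRingEnd ℂ) * B.submatrix e e = 1 := by
    rw [← Matrix.submatrix_map, Matrix.submatrix_mul_equiv, conj_pairCutoff_mul_self hd rfl,
      Matrix.submatrix_one_equiv]
  have hdet : (-1) ^ Fintype.card (Fin n) * P.det * (B.submatrix e e).det = 1 := by
    rw [Fintype.card_fin, Matrix.det_submatrix_equiv_self, neg_one_pow_mul_det_pairCutoff hd rfl]
  rw [eval_sub, eval_mul, eval_mul, eval_X, eval_C, opuc_eq_charpoly_mul α (n + 1) n,
    ← Matrix.charpoly_reindex e.symm, Matrix.reindex_apply, Equiv.symm_symm,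
    ← Matrix.submatrix_mul_equiv _ _ e e e, pairCutoff_succ _ _ rfl, eval_charpoly_eq_det,
    det_smul_one_sub_fromBlocks_mul z _ (conj_pairCutoff_mul_self hd rfl) hB, hdet, one_mul,
    opuc_eq_charpoly_mul α n n, eval_charpoly_eq_det, opucStar_eq_charpolyRev α n (n + 1),
    eval_charpolyRev_eq_det, show (n + 1 + 1) % 2 = n % 2 by omega, Matrix.map_mul]
  rfl

theorem map_conj_map_conj (q : ℂ[X]) : (q.map (starRingEnd ℂ)).map (starRingEnd ℂ) = q := by
  rw [Polynomial.map_map, show (starRingEnd ℂ).comp (starRingEnd ℂ) = RingHom.id ℂ from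
    RingHom.ext Complex.conj_conj, Polynomial.map_id]

theorem opucStar_succ {α : ℕ → ℂ} (h : ∀ n, ‖α n‖ ≤ 1) (n : ℕ) :
    opucStar α (n + 1) = opucStar α n - C (α n) * (X * opuc α n) := by
  have hX : (X * (opuc α n).map (starRingEnd ℂ)).reflect (n + 1) = opucStar α n := by
    rw [add_comm n 1, reflect_mul _ _ natDegree_X_le
      (by rw [natDegree_map, natDegree_opuc]), reflect_one_X, one_mul, opucStar]
  have hstar : ((opucStar α n).map (starRingEnd ℂ)).reflect (n + 1) = X * opuc α n := by
    have hdeg : ((opuc α n).reflect n).natDegree ≤ n :=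
      natDegree_reflect_le.trans (by rw [natDegree_opuc, max_self])
    have hmul := reflect_mul (1 : ℂ[X]) _ (natDegree_one.trans_le zero_le_one) hdeg
    rwa [one_mul, reflect_reflect, reflect_one, pow_one, add_comm 1 n, ← map_conj_map_conj
      (opuc α n), reflect_map, map_conj_map_conj] at hmul
  rw [opucStar, opuc_succ h, Polynomial.map_sub, Polynomial.map_mul, Polynomial.map_mul, map_X,
    map_C, Complex.conj_conj, reflect_sub, hX, reflect_C_mul, hstar]

theorem opuc_congr {α α' : ℕ → ℂ} {n : ℕ} (h : ∀ i < n, α i = α' i) : opuc α n = opuc α' n := by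
  have hA : ∀ m ≤ n, cmvA α m = cmvA α' m := by
    rintro (_ | m) hm
    · rfl
    · exact h m hm
  have hR : ∀ m ≤ n, cmvR α m = cmvR α' m := fun m hm => by rw [cmvR, cmvR, hA m hm]
  rw [opuc, opuc, cmvCutoff_eq_mul, cmvCutoff_eq_mul, pairCutoff_congr hA hR,
    pairCutoff_congr hA hR]

theorem norm_update_le {α : ℕ → ℂ} (h : ∀ n, ‖α n‖ ≤ 1) {β : ℂ} (hβ : ‖β‖ = 1) (m n : ℕ) :
    ‖Function.update α m β n‖ ≤ 1 := by
  by_cases hn : n = m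
  · rw [hn, Function.update_self, hβ]
  · rw [Function.update_of_ne hn]
    exact h n

theorem popuc_succ {α : ℕ → ℂ} (h : ∀ n, ‖α n‖ ≤ 1) {β : ℂ} (hβ : ‖β‖ = 1) (n : ℕ) :
    popuc β α (n + 1) = X * opuc α n - C (conj β) * opucStar α n := by
  have hlow : opuc (Function.update α n β) n = opuc α n :=
    opuc_congr fun i hi => Function.update_of_ne hi.ne _ _
  have hrec := opuc_succ (norm_update_le h hβ n) n
  rwa [opucStar, hlow, Function.update_self] at hrec

/-! ### Reversal of the coefficients -/

theorem conj_mul_self_of_norm_eq_one {β : ℂ} (hβ : ‖β‖ = 1) : conj β * β = 1 := by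
  rw [mul_comm, Complex.mul_conj, Complex.normSq_eq_norm_sq, hβ, one_pow, Complex.ofReal_one]

/-- The diagonal entries of the unitary matrices that intertwine a pair rotation with the flip of
the pair rotation with reversed parameters. -/
def reversalPhase (β : ℂ) (s i : ℕ) : ℂ := if i % 2 = s then β else 1

theorem reversalPhase_ne_zero {β : ℂ} (hβ : ‖β‖ = 1) (s i : ℕ) : reversalPhase β s i ≠ 0 := by
  unfold reversalPhase
  split_ifs
  · exact norm_ne_zero_iff.1 (hβ.trans_ne one_ne_zero)
  · exact one_ne_zero

theorem pairMatrix_reverse {A R A' R' : ℕ → ℂ} {β : ℂ} (hβ : ‖β‖ = 1) {n s : ℕ} (hs : s < 2)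
    (hA : ∀ m m', m + m' = n + 1 → A' m = -conj (A m') * β)
    (hR : ∀ m m', m + m' = n + 1 → R' m = R m') (hR0 : R 0 = 0) (hR0' : R' 0 = 0)
    {i i' k k' : ℕ} (hi : i + i' = n) (hk : k + k' = n) :
    pairMatrix A' R' s i k * reversalPhase β s k =
      reversalPhase β (1 - s) i * pairMatrix A R ((n + 1 + s) % 2) i' k' := by
  have hββ := conj_mul_self_of_norm_eq_one hβ
  have h0 := hA i (i' + 1) (by omega)
  have h1 := hA (i + 1) i' (by omega)
  have h2 := hR i (i' + 1) (by omega)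
  have h3 := hR (i + 1) i' (by omega)
  rw [pairMatrix_apply, pairMatrix_apply, h0, h1, h3]
  simp only [map_mul, map_neg, Complex.conj_conj]
  unfold reversalPhase
  grind (splits := 30)

/-- The coefficients `-ᾱ_{n-1} β, …, -ᾱ_0 β, β, -ω̄ β, (-ω̄)² β, …`. They start with the reversed
coefficients `α_0, …, α_{n-1}`; the coefficients of modulus one that follow decouple the first
`n + 1` basis vectors and make the other ones span eigenspaces of eigenvalue `ω`. -/
noncomputable def revSeq (α : ℕ → ℂ) (β ω : ℂ) (n l : ℕ) : ℂ :=
  if l < n then -conj (α (n - 1 - l)) * β else (-conj ω) ^ (l - n) * β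

theorem norm_revSeq_of_le (α : ℕ → ℂ) {β ω : ℂ} (hβ : ‖β‖ = 1) (hω : ‖ω‖ = 1)
    {n l : ℕ} (hl : n ≤ l) : ‖revSeq α β ω n l‖ = 1 := by
  rw [revSeq, if_neg hl.not_gt, norm_mul, norm_pow, norm_neg, RCLike.norm_conj, hω, hβ, one_pow,
    one_mul]

theorem norm_revSeq_le {α : ℕ → ℂ} (h : ∀ n, ‖α n‖ ≤ 1) {β ω : ℂ} (hβ : ‖β‖ = 1) (hω : ‖ω‖ = 1)
    (n l : ℕ) : ‖revSeq α β ω n l‖ ≤ 1 := by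
  rcases lt_or_ge l n with hl | hl
  · rw [revSeq, if_pos hl, norm_mul, norm_neg, RCLike.norm_conj, hβ, mul_one]
    exact h _
  · exact (norm_revSeq_of_le α hβ hω hl).le

theorem cmvA_revSeq (α : ℕ → ℂ) {β : ℂ} (hβ : ‖β‖ = 1) (ω : ℂ) {n m m' : ℕ} (hm : m + m' = n + 1) :
    cmvA (revSeq α β ω n) m = -conj (cmvA (Function.update α n β) m') * β := by
  rcases m with _ | m
  · obtain rfl : m' = n + 1 := by omega
    simp [cmvA, conj_mul_self_of_norm_eq_one hβ]
  · rcases m' with _ | m'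
    · obtain rfl : m = n := by omega
      simp [cmvA, revSeq]
    · simp only [cmvA, revSeq]
      rw [if_pos (by omega), Function.update_of_ne (by omega), show n - 1 - m = m' by omega]

theorem cmvR_revSeq (α : ℕ → ℂ) {β : ℂ} (hβ : ‖β‖ = 1) (ω : ℂ) {n m m' : ℕ} (hm : m + m' = n + 1) :
    cmvR (revSeq α β ω n) m = cmvR (Function.update α n β) m' := by
  rw [cmvR, cmvA_revSeq α hβ ω hm, norm_mul, norm_neg, RCLike.norm_conj, hβ, mul_one, cmvR]

theorem pairCutoff_revSeq_mul_diagonal (α : ℕ → ℂ) {β : ℂ} (hβ : ‖β‖ = 1) (ω : ℂ) (n : ℕ) {s : ℕ}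
    (hs : s < 2) :
    pairCutoff (cmvA (revSeq α β ω n)) (cmvR (revSeq α β ω n)) s (n + 1) *
        Matrix.diagonal (fun i : Fin (n + 1) => reversalPhase β s i) =
      Matrix.diagonal (fun i : Fin (n + 1) => reversalPhase β (1 - s) i) *
        (pairCutoff (cmvA (Function.update α n β)) (cmvR (Function.update α n β))
          ((n + 1 + s) % 2) (n + 1)).submatrix Fin.rev Fin.rev := by
  have hrev (i : Fin (n + 1)) : (i : ℕ) + (i.rev : ℕ) = n := by
    rw [Fin.val_rev, Nat.add_sub_add_right]
    exact Nat.add_sub_of_le (Nat.lt_succ_iff.1 i.2)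
  ext i k
  rw [Matrix.mul_diagonal, Matrix.diagonal_mul]
  exact pairMatrix_reverse hβ hs (fun _ _ => cmvA_revSeq α hβ ω) (fun _ _ => cmvR_revSeq α hβ ω)
    (cmvR_zero _) (cmvR_zero _) (hrev i) (hrev k)

theorem cmvCutoff_revSeq_mul_diagonal (α : ℕ → ℂ) {β : ℂ} (hβ : ‖β‖ = 1) (ω : ℂ) (n : ℕ) :
    cmvCutoff (revSeq α β ω n) (n + 1) *
        Matrix.diagonal (fun i : Fin (n + 1) => reversalPhase β 1 i) =
      Matrix.diagonal (fun i : Fin (n + 1) => reversalPhase β 1 i) *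
        (pairCutoff (cmvA (Function.update α n β)) (cmvR (Function.update α n β))
            ((n + 1) % 2) (n + 1) *
          pairCutoff (cmvA (Function.update α n β)) (cmvR (Function.update α n β))
            ((n + 1 + 1) % 2) (n + 1)).submatrix Fin.rev Fin.rev := by
  rw [cmvCutoff_eq_mul, mul_assoc, pairCutoff_revSeq_mul_diagonal α hβ ω n one_lt_two, ← mul_assoc,
    Nat.sub_self, pairCutoff_revSeq_mul_diagonal α hβ ω n zero_lt_two, mul_assoc]
  exact congrArg _ (Matrix.submatrix_mul_equiv _ _ Fin.rev Fin.revPerm Fin.rev)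

theorem det_submatrix_eq_of_mul_diagonal_eq {m k S : Type*} [Fintype m] [DecidableEq m] [Fintype k]
    [DecidableEq k] [CommRing S] [IsDomain S] {M M' : Matrix m m S} {d : m → S}
    (hd : ∀ i, d i ≠ 0) (h : M * Matrix.diagonal d = Matrix.diagonal d * M') (f : k → m) (z : S) :
    ((z • 1 - M).submatrix f f).det = ((z • 1 - M').submatrix f f).det := by
  have hM : (z • 1 - M).submatrix f f * Matrix.diagonal (d ∘ f) =
      Matrix.diagonal (d ∘ f) * (z • 1 - M').submatrix f f := by
    ext i j
    have hij := congrFun (congrFun h (f i)) (f j)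
    simp only [Matrix.mul_diagonal, Matrix.diagonal_mul, Matrix.submatrix_apply, Matrix.sub_apply,
      Matrix.smul_apply, Matrix.one_apply, Function.comp_apply, smul_eq_mul] at hij ⊢
    split_ifs with hfij <;> grind
  have hdet : (Matrix.diagonal (d ∘ f)).det ≠ 0 := by
    rw [Matrix.det_diagonal]
    exact Finset.prod_ne_zero_iff.2 fun i _ => hd _
  refine mul_right_cancel₀ hdet ?_
  rw [← Matrix.det_mul, hM, Matrix.det_mul, mul_comm]

theorem charpoly_cutoff_revSeq (α : ℕ → ℂ) {β : ℂ} (hβ : ‖β‖ = 1) (ω : ℂ) (n : ℕ) :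
    (cmvCutoff (revSeq α β ω n) (n + 1)).charpoly = popuc β α (n + 1) := by
  refine Polynomial.funext fun z => ?_
  have hdet := det_submatrix_eq_of_mul_diagonal_eq
    (fun i : Fin (n + 1) => reversalPhase_ne_zero hβ 1 i) (cmvCutoff_revSeq_mul_diagonal α hβ ω n)
    id z
  rw [Matrix.submatrix_id_id, Matrix.submatrix_id_id, ← eval_charpoly_eq_det,
    ← eval_charpoly_eq_det] at hdet
  rw [hdet, popuc, ← opuc, Nat.add_sub_cancel, opuc_eq_charpoly_mul _ _ (n + 1)]
  rw [← Matrix.charpoly_reindex Fin.revPerm (_ * _), Matrix.reindex_apply, Fin.revPerm_symm]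
  rfl

theorem pairCutoff_mul_submatrix_castSucc (A R : ℕ → ℂ) (n : ℕ) :
    (pairCutoff A R ((n + 1) % 2) (n + 1) * pairCutoff A R ((n + 1 + 1) % 2) (n + 1)).submatrix
        Fin.castSucc Fin.castSucc =
      pairCutoff A R ((n + 1) % 2) n * pairCutoff A R ((n + 1 + 1) % 2) n := by
  ext i j
  have hlast : pairMatrix A R ((n + 1 + 1) % 2) n j = 0 := by
    rw [pairMatrix_apply, if_pos (by omega), if_neg (by omega), if_neg (by omega), add_zero]
  simp only [Matrix.submatrix_apply, Matrix.mul_apply, Fin.sum_univ_castSucc, pairCutoff,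
    Matrix.of_apply, Fin.val_castSucc, Fin.val_last, hlast, mul_zero, add_zero]

theorem adjugate_cutoff_revSeq (α : ℕ → ℂ) {β : ℂ} (hβ : ‖β‖ = 1) (ω : ℂ) (n : ℕ) (z : ℂ) :
    (z • 1 - cmvCutoff (revSeq α β ω n) (n + 1)).adjugate 0 0 = (opuc α n).eval z := by
  rw [Matrix.adjugate_fin_succ_eq_det_submatrix, Fin.val_zero, add_zero, pow_zero, one_mul,
    Fin.succAbove_zero, det_submatrix_eq_of_mul_diagonal_eq
      (fun i : Fin (n + 1) => reversalPhase_ne_zero hβ 1 i)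
      (cmvCutoff_revSeq_mul_diagonal α hβ ω n) Fin.succ z,
    ← opuc_congr (α := Function.update α n β) fun i hi => Function.update_of_ne hi.ne _ _,
    opuc_eq_charpoly_mul _ _ (n + 1), eval_charpoly_eq_det, ← pairCutoff_mul_submatrix_castSucc,
    ← Matrix.det_submatrix_equiv_self Fin.revPerm]
  congr 1
  ext i j
  simp [Matrix.one_apply, Fin.rev_succ]

/-! ### Finite CMV matrices as blocks of CMV operators -/

theorem aeval_apply_of_intertwine {𝕜 E V : Type*} [NontriviallyNormedField 𝕜]
    [NormedAddCommGroup E] [NormedSpace 𝕜 E] [AddCommGroup V] [Module 𝕜 V] {T : E →L[𝕜] E}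
    {S : Module.End 𝕜 V} {f : V →ₗ[𝕜] E} (h : ∀ v, T (f v) = f (S v)) (P : 𝕜[X]) (v : V) :
    aeval T P (f v) = f (aeval S P v) := by
  induction P using Polynomial.induction_on generalizing v with
  | C a => simp [Algebra.algebraMap_eq_smul_one]
  | add P Q hP hQ => simp [hP, hQ]
  | monomial n a ih =>
    have hstep : (C a * X ^ (n + 1) : 𝕜[X]) = C a * X ^ n * X := by rw [pow_succ, mul_assoc]
    rw [hstep, map_mul (aeval T) (C a * X ^ n) X, map_mul (aeval S) (C a * X ^ n) X, aeval_X,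
      aeval_X, mul_apply_eq_comp, h, ih, Module.End.mul_apply]

/-- The inclusion of `ℂⁿ` into `ℓ²(ℕ₀)`. -/
noncomputable def finInclusion (n : ℕ) : (Fin n → ℂ) →ₗ[ℂ] Ell2 :=
  Fintype.linearCombination ℂ fun j : Fin n => ell2Basis j

theorem finInclusion_single {n : ℕ} (j : Fin n) :
    finInclusion n (Pi.single j 1) = ell2Basis j := by
  rw [finInclusion, Fintype.linearCombination_apply_single, one_smul]

theorem orthonormal_ell2Basis_fin (n : ℕ) : Orthonormal ℂ fun j : Fin n => ell2Basis j :=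
  ell2Basis.orthonormal.comp _ Fin.val_injective

theorem inner_finInclusion {n : ℕ} (v : Fin n → ℂ) (i : Fin n) :
    inner ℂ (ell2Basis i) (finInclusion n v) = v i :=
  (orthonormal_ell2Basis_fin n).inner_right_fintype v i

theorem finInclusion_injective (n : ℕ) : Function.Injective (finInclusion n) :=
  linearIndependent_iff_injective_fintypeLinearCombination.1
    (orthonormal_ell2Basis_fin n).linearIndependent

theorem vecE0_eq : vecE0 = ell2Basis 0 := (ell2Basis_apply 0).symm

theorem norm_vecE0 : ‖vecE0‖ = 1 := by
  rw [vecE0_eq]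
  exact ell2Basis.orthonormal.1 0

instance nontrivial_ell2 : Nontrivial Ell2 :=
  ⟨⟨vecE0, 0, fun h => by simpa [h] using norm_vecE0⟩⟩

theorem cmvMatrix_eq_zero_of_cmvR_eq_zero {γ : ℕ → ℂ} {n i j : ℕ} (hn : cmvR γ (n + 1) = 0)
    (hi : n < i) (hj : j ≤ n) : cmvMatrix γ i j = 0 := by
  unfold cmvMatrix
  grind

theorem cmvOperator_finInclusion {γ : ℕ → ℂ} (h : ∀ n, ‖γ n‖ ≤ 1) {n : ℕ}
    (hn : cmvR γ (n + 1) = 0) (v : Fin (n + 1) → ℂ) :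
    cmvOperator γ (finInclusion (n + 1) v) =
      finInclusion (n + 1) (Matrix.toLin' (cmvCutoff γ (n + 1)) v) := by
  refine LinearMap.congr_fun (f := (cmvOperator γ : Ell2 →ₗ[ℂ] Ell2) ∘ₗ finInclusion (n + 1))
    (g := finInclusion (n + 1) ∘ₗ Matrix.toLin' (cmvCutoff γ (n + 1)))
    (LinearMap.pi_ext' fun j => LinearMap.ext_ring ?_) v
  change cmvOperator γ (finInclusion (n + 1) (Pi.single j 1)) =
    finInclusion (n + 1) ((cmvCutoff γ (n + 1)).mulVec (Pi.single j 1))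
  ext i
  rw [finInclusion_single, cmvOperator_basis_apply h, Matrix.mulVec_single_one, finInclusion,
    Fintype.linearCombination_apply, lp.coeFn_sum, Finset.sum_apply]
  simp only [lp.coeFn_smul, Pi.smul_apply, ell2Basis_coord, smul_eq_mul, mul_ite, mul_one, mul_zero]
  rcases lt_or_ge n i with hi | hi
  · rw [cmvMatrix_eq_zero_of_cmvR_eq_zero hn hi (Nat.lt_succ_iff.1 j.2)]
    exact (Finset.sum_eq_zero fun l _ => if_neg (by have := l.2; omega)).symm
  · rw [Finset.sum_eq_single ⟨i, Nat.lt_succ_of_le hi⟩ (fun l _ hl => if_neg fun h => hl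
      (Fin.ext h.symm)) fun hl => absurd (Finset.mem_univ _) hl, if_pos rfl]
    rfl

theorem cmvR_eq_zero {γ : ℕ → ℂ} {n : ℕ} (h : ‖γ n‖ = 1) : cmvR γ (n + 1) = 0 := by
  simp [cmvR, cmvA, h]

section Reversed

variable {α : ℕ → ℂ} {β : ℂ}

theorem norm_eq_one_of_popuc_eval_eq_zero (h : ∀ n, ‖α n‖ ≤ 1) (hβ : ‖β‖ = 1) {n : ℕ} {z : ℂ}
    (hz : (popuc β α (n + 1)).eval z = 0) : ‖z‖ = 1 := by
  rw [← charpoly_cutoff_revSeq α hβ 1 n, ← Matrix.charpoly_toLin', ← IsRoot.def,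
    ← Module.End.hasEigenvalue_iff_isRoot_charpoly] at hz
  obtain ⟨v, hv⟩ := hz.exists_hasEigenvector
  have hγ := norm_revSeq_le h hβ (norm_one (α := ℂ)) n
  have hR := cmvR_eq_zero (norm_revSeq_of_le α hβ (norm_one (α := ℂ)) (le_refl n))
  have hisom := norm_cmvOperator_apply hγ (finInclusion (n + 1) v)
  rw [cmvOperator_finInclusion hγ hR, hv.apply_eq_smul, map_smul, norm_smul] at hisom
  have hv0 : finInclusion (n + 1) v ≠ 0 := (map_ne_zero_iff _ (finInclusion_injective _)).2 hv.2
  exact (mul_eq_right₀ (norm_ne_zero_iff.2 hv0)).1 hisom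

variable {ω : ℂ} {n : ℕ}

theorem cmvOperator_revSeq_basis (h : ∀ n, ‖α n‖ ≤ 1) (hβ : ‖β‖ = 1) (hω : ‖ω‖ = 1) {l : ℕ}
    (hl : n < l) : cmvOperator (revSeq α β ω n) (ell2Basis l) = ω • ell2Basis l := by
  have hR : ∀ m, n < m → cmvR (revSeq α β ω n) m = 0 := by
    rintro (_ | m) hm
    · exact absurd hm (Nat.not_lt_zero n)
    · exact cmvR_eq_zero (norm_revSeq_of_le α hβ hω (Nat.lt_succ_iff.1 hm))
  have hdiag : -conj (cmvA (revSeq α β ω n) (l + 1)) * cmvA (revSeq α β ω n) l = ω := by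
    obtain ⟨q, rfl⟩ : ∃ q, l = n + q + 1 := ⟨l - n - 1, by omega⟩
    have hωω : conj ((-conj ω) ^ q * β) * ((-conj ω) ^ q * β) = 1 :=
      conj_mul_self_of_norm_eq_one (by simp [hω, hβ])
    simp only [cmvA, revSeq]
    rw [if_neg (by omega), if_neg (by omega), show n + q + 1 - n = q + 1 by omega,
      Nat.add_sub_cancel_left, pow_succ', mul_assoc, map_mul, map_neg, Complex.conj_conj]
    linear_combination ω * hωω
  ext i
  rw [cmvOperator_basis_apply (norm_revSeq_le h hβ hω n), lp.coeFn_smul, Pi.smul_apply,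
    ell2Basis_coord, smul_eq_mul, cmvMatrix]
  grind

theorem aeval_cmvOperator_revSeq (h : ∀ n, ‖α n‖ ≤ 1) (hβ : ‖β‖ = 1) (hω : ‖ω‖ = 1)
    (hroot : (popuc β α (n + 1)).eval ω = 0) :
    aeval (cmvOperator (revSeq α β ω n)) (popuc β α (n + 1)) = 0 := by
  refine ContinuousLinearMap.ext_on dense_span_ell2Basis ?_
  rintro _ ⟨l, rfl⟩
  rcases le_or_gt l n with hl | hl
  · have hR := cmvR_eq_zero (norm_revSeq_of_le α hβ hω (le_refl n))
    rw [← finInclusion_single (⟨l, Nat.lt_succ_of_le hl⟩ : Fin (n + 1)),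
      aeval_apply_of_intertwine (cmvOperator_finInclusion (norm_revSeq_le h hβ hω n) hR),
      ← charpoly_cutoff_revSeq α hβ ω n, ← Matrix.charpoly_toLin', LinearMap.aeval_self_charpoly]
    exact map_zero _
  · have hline := aeval_apply_of_intertwine (T := cmvOperator (revSeq α β ω n))
      (S := algebraMap ℂ (Module.End ℂ ℂ) ω) (f := LinearMap.toSpanSingleton ℂ Ell2 (ell2Basis l))
      (fun c => by simp [cmvOperator_revSeq_basis h hβ hω hl, mul_smul, smul_comm c])
      (popuc β α (n + 1)) 1
    rw [aeval_algebraMap_apply, coe_aeval_eq_eval, hroot] at hline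
    simpa using hline

theorem popuc_eval_eq_zero_of_mem_spectrum (h : ∀ n, ‖α n‖ ≤ 1) (hβ : ‖β‖ = 1) (hω : ‖ω‖ = 1)
    (hroot : (popuc β α (n + 1)).eval ω = 0) {w : ℂ}
    (hw : w ∈ spectrum ℂ (cmvOperator (revSeq α β ω n))) : (popuc β α (n + 1)).eval w = 0 := by
  have hmem := spectrum.subset_polynomial_aeval _ (popuc β α (n + 1)) ⟨w, hw, rfl⟩
  rwa [aeval_cmvOperator_revSeq h hβ hω hroot, spectrum.zero_eq] at hmem

theorem mFun_revSeq (h : ∀ n, ‖α n‖ ≤ 1) (hβ : ‖β‖ = 1) (hω : ‖ω‖ = 1)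
    (hroot : (popuc β α (n + 1)).eval ω = 0) {z : ℂ} (hz : (popuc β α (n + 1)).eval z ≠ 0) :
    mFun (revSeq α β ω n) z = (opuc α n).eval z / (popuc β α (n + 1)).eval z := by
  have hres : z ∈ resolventSet ℂ (cmvOperator (revSeq α β ω n)) := by
    by_contra hc
    exact hz (popuc_eval_eq_zero_of_mem_spectrum h hβ hω hroot hc)
  set M := z • 1 - cmvCutoff (revSeq α β ω n) (n + 1) with hM
  set v := M.adjugate.mulVec (Pi.single 0 1) with hv
  have hMv : M.mulVec v = (popuc β α (n + 1)).eval z • Pi.single 0 1 := by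
    rw [hv, Matrix.mulVec_mulVec, Matrix.mul_adjugate, Matrix.smul_mulVec, Matrix.one_mulVec,
      hM, ← eval_charpoly_eq_det, charpoly_cutoff_revSeq α hβ]
  have hv0 : v 0 = (opuc α n).eval z := by
    rw [hv, Matrix.mulVec_single_one, Matrix.col_apply, hM, adjugate_cutoff_revSeq α hβ]
  have hsolve : z • finInclusion (n + 1) v -
      cmvOperator (revSeq α β ω n) (finInclusion (n + 1) v) =
        (popuc β α (n + 1)).eval z • vecE0 := by
    rw [cmvOperator_finInclusion (norm_revSeq_le h hβ hω n)
      (cmvR_eq_zero (norm_revSeq_of_le α hβ hω (le_refl n))), ← map_smul, ← map_sub, vecE0_eq]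
    rw [hM, Matrix.sub_mulVec, Matrix.smul_mulVec, Matrix.one_mulVec] at hMv
    rw [Matrix.toLin'_apply, hMv, map_smul, finInclusion_single, Fin.val_zero]
  have hinner := congrArg (inner ℂ vecE0) (resolvent_sub_apply hres (finInclusion (n + 1) v))
  rw [hsolve, map_smul, inner_smul_right, vecE0_eq] at hinner
  rw [eq_div_iff hz, ← hv0, ← inner_finInclusion v 0, mFun, vecE0_eq, mul_comm]
  exact hinner

theorem exists_cmvOperator_mFun_eq_div (h : ∀ n, ‖α n‖ ≤ 1) (hβ : ‖β‖ = 1) (n : ℕ) :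
    ∃ γ : ℕ → ℂ, (∀ l, ‖γ l‖ ≤ 1) ∧ (∀ l < n, γ l = -conj (α (n - 1 - l)) * β) ∧
      (∀ w ∈ spectrum ℂ (cmvOperator γ), (popuc β α (n + 1)).eval w = 0) ∧
      ∀ z, (popuc β α (n + 1)).eval z ≠ 0 →
        mFun γ z = (opuc α n).eval z / (popuc β α (n + 1)).eval z := by
  have hdeg : (popuc β α (n + 1)).degree ≠ 0 := by
    rw [popuc, Matrix.charpoly_degree_eq_dim, Fintype.card_fin]
    exact_mod_cast n.succ_ne_zero
  obtain ⟨ω, hroot⟩ := IsAlgClosed.exists_root _ hdeg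
  have hω := norm_eq_one_of_popuc_eval_eq_zero h hβ hroot
  exact ⟨revSeq α β ω n, norm_revSeq_le h hβ hω n, fun l hl => if_pos hl,
    fun w => popuc_eval_eq_zero_of_mem_spectrum h hβ hω hroot,
    fun z => mFun_revSeq h hβ hω hroot⟩

end Reversed

/-! ### Ratios of polynomials -/

theorem tendstoLocallyUniformlyOn_of_tendsto_prod {ι X E : Type*} [TopologicalSpace X]
    [PseudoMetricSpace E] {l : Filter ι} [l.NeBot] {F : ι → X → E} {f : X → E} {s : Set X}
    (h : ∀ x ∈ s, Tendsto (fun q : ι × X => F q.1 q.2) (l ×ˢ 𝓝[s] x) (𝓝 (f x))) :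
    TendstoLocallyUniformlyOn F f l s := by
  rw [Metric.tendstoLocallyUniformlyOn_iff]
  intro ε hε x hx
  obtain ⟨S, hS, V, hV, hSV⟩ :=
    eventually_prod_iff.1 (Metric.tendsto_nhds.1 (h x hx) _ (half_pos hε))
  refine ⟨{y | V y} ∩ s, inter_mem hV self_mem_nhdsWithin, hS.mono fun i hi y hy => ?_⟩
  have hpoint : Tendsto (fun i => F i y) l (𝓝 (f y)) :=
    (h y hy.2).comp (tendsto_id.prodMk (tendsto_const_pure.mono_right (pure_le_nhdsWithin hy.2)))
  have hlimit : dist (f y) (f x) ≤ ε / 2 :=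
    le_of_tendsto (hpoint.dist tendsto_const_nhds) (hS.mono fun i hi => (hSV hi hy.1).le)
  linarith [hSV hi hy.1, dist_triangle_right (f y) (F i y) (f x)]

/-- The polynomials `P i` do not vanish near `z` from some index on, and `A i / P i → x` locally
uniformly at `z`; the latter is expressed by joint convergence along `l ×ˢ 𝓝 z`. -/
def RatioTendsto {ι 𝕜 : Type*} [NormedField 𝕜] (l : Filter ι) (A P : ι → 𝕜[X]) (z x : 𝕜) : Prop :=
  (∀ᶠ q in l ×ˢ 𝓝 z, (P q.1).eval q.2 ≠ 0) ∧
    Tendsto (fun q : ι × 𝕜 => (A q.1).eval q.2 / (P q.1).eval q.2) (l ×ˢ 𝓝 z) (𝓝 x)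

namespace RatioTendsto

variable {ι 𝕜 : Type*} [NormedField 𝕜] {l : Filter ι} {A B P Q : ι → 𝕜[X]} {x y z : 𝕜}

theorem self (h : RatioTendsto l A P z x) : RatioTendsto l P P z 1 :=
  ⟨h.1, tendsto_const_nhds.congr' (h.1.mono fun _ hq => (div_self hq).symm)⟩

theorem congr (h : RatioTendsto l A P z x) (hA : A =ᶠ[l] B) (hP : P =ᶠ[l] Q) :
    RatioTendsto l B Q z x := by
  have hA' : ∀ᶠ q : ι × 𝕜 in l ×ˢ 𝓝 z, A q.1 = B q.1 := hA.prod_inl (𝓝 z)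
  have hP' : ∀ᶠ q : ι × 𝕜 in l ×ˢ 𝓝 z, P q.1 = Q q.1 := hP.prod_inl (𝓝 z)
  constructor
  · filter_upwards [h.1, hP'] with q hq hPQ
    rwa [← hPQ]
  · refine h.2.congr' ?_
    filter_upwards [hA', hP'] with q hAB hPQ
    rw [hAB, hPQ]

theorem sub (hA : RatioTendsto l A P z x) (hB : RatioTendsto l B P z y) :
    RatioTendsto l (fun i => A i - B i) P z (x - y) :=
  ⟨hA.1, (hA.2.sub hB.2).congr fun q => by simp only [eval_sub, sub_div]⟩

theorem X_mul (h : RatioTendsto l A P z x) : RatioTendsto l (fun i => X * A i) P z (z * x) :=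
  ⟨h.1, (tendsto_snd.mul h.2).congr fun q => by simp only [eval_mul, eval_X, mul_div_assoc]⟩

theorem C_mul (h : RatioTendsto l A P z x) {c : ι → 𝕜} (hc : Tendsto c l (𝓝 y)) :
    RatioTendsto l (fun i => C (c i) * A i) P z (y * x) :=
  ⟨h.1, ((hc.comp tendsto_fst).mul h.2).congr fun q => by
    simp only [eval_mul, eval_C, mul_div_assoc, Function.comp_apply]⟩

theorem mul (hA : RatioTendsto l A P z x) (hB : RatioTendsto l B Q z y) :
    RatioTendsto l (fun i => A i * B i) (fun i => P i * Q i) z (x * y) := by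
  refine ⟨?_, (hA.2.mul hB.2).congr fun q => by simp only [eval_mul, div_mul_div_comm]⟩
  filter_upwards [hA.1, hB.1] with q hP hQ
  simpa only [eval_mul] using mul_ne_zero hP hQ

theorem div (hA : RatioTendsto l A P z x) (hB : RatioTendsto l B P z y) (hy : y ≠ 0) :
    RatioTendsto l A B z (x / y) := by
  have hB0 : ∀ᶠ q in l ×ˢ 𝓝 z, (B q.1).eval q.2 ≠ 0 :=
    (hB.2.eventually_ne hy).mono fun q hq h0 => hq (by rw [h0, zero_div])
  refine ⟨hB0, (hA.2.div hB.2 hy).congr' ?_⟩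
  filter_upwards [hA.1] with q hq
  exact div_div_div_cancel_right₀ hq _ _

theorem trans (hA : RatioTendsto l A P z x) (hP : RatioTendsto l P Q z y) :
    RatioTendsto l A Q z (x * y) := by
  refine ⟨hP.1, (hA.2.mul hP.2).congr' ?_⟩
  filter_upwards [hA.1] with q hq
  exact div_mul_div_cancel₀ hq

theorem unique [l.NeBot] (h : RatioTendsto l A P z x) (h' : RatioTendsto l A P z y) : x = y :=
  tendsto_nhds_unique h.2 h'.2

theorem tendstoUniformlyOn [l.NeBot] {L : 𝕜 → 𝕜} {K : Set 𝕜} (hK : IsCompact K)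
    (h : ∀ z ∈ K, RatioTendsto l A P z (L z)) :
    (∀ᶠ i in l, ∀ z ∈ K, (P i).eval z ≠ 0) ∧
      TendstoUniformlyOn (fun i z => (A i).eval z / (P i).eval z) L l K := by
  constructor
  · have hne : ∀ᶠ q : ι × 𝕜 in l ×ˢ 𝓝ˢ K, (P q.1).eval q.2 ≠ 0 := by
      simp only [hK.prod_nhdsSet_eq_biSup, eventually_iSup]
      exact fun z hz => (h z hz).1
    obtain ⟨S, hS, V, hV, hSV⟩ := eventually_prod_iff.1 hne
    exact hS.mono fun i hi z hz => hSV hi (hV.self_of_nhdsSet z hz)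
  · rw [← tendstoLocallyUniformlyOn_iff_tendstoUniformlyOn_of_compact hK]
    exact tendstoLocallyUniformlyOn_of_tendsto_prod fun z hz =>
      (h z hz).2.mono_left (prod_mono le_rfl nhdsWithin_le_nhds)

end RatioTendsto

theorem ratioTendsto_opuc_popuc {ι : Type*} {l : Filter ι} [l.NeBot] {α : ι → ℕ → ℂ} {n : ι → ℕ}
    {γ : ℕ → ℂ} {β z : ℂ} {δ : ℝ} (h : ∀ i m, ‖α i m‖ ≤ 1) (hβ : ‖β‖ = 1) (hn : Tendsto n l atTop)
    (hlim : ∀ m, Tendsto (fun i => -conj (α i (n i - 1 - m))) l (𝓝 (γ m))) (hδ : 0 < δ)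
    (hz : ∀ᶠ i in l, ∀ w, (popuc β (α i) (n i + 1)).eval w = 0 → δ ≤ ‖z - w‖) :
    z ∈ resolventSet ℂ (cmvOperator fun m => γ m * β) ∧
      RatioTendsto l (fun i => opuc (α i) (n i)) (fun i => popuc β (α i) (n i + 1)) z
        (mFun (fun m => γ m * β) z) := by
  choose γ' hγ' hcoeff hspec hm using fun i => exists_cmvOperator_mFun_eq_div (h i) hβ (n i)
  have hlim' (m : ℕ) : Tendsto (fun i => γ' i m) l (𝓝 (γ m * β)) :=
    ((hlim m).mul_const β).congr' ((hn.eventually_gt_atTop m).mono fun i hi => (hcoeff i m hi).symm)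
  have hγ (m : ℕ) : ‖γ m * β‖ ≤ 1 := le_of_tendsto' (hlim' m).norm fun i => hγ' i m
  have hT (i : ι) := isStarNormal_of_mem_unitary (cmvOperator_mem_unitary (hγ' i))
  have hstrong := tendsto_cmvOperator_apply hγ' hγ hlim'
  have hdist : ∀ᶠ i in l, ∀ w ∈ spectrum ℂ (cmvOperator (γ' i)), δ ≤ ‖z - w‖ :=
    hz.mono fun i hi w hw => hi w (hspec i w hw)
  have hres := mem_resolventSet_of_tendsto hT
    (isStarNormal_of_mem_unitary (cmvOperator_mem_unitary hγ)) hstrong hδ hdist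
  have hne : ∀ᶠ q : ι × ℂ in l ×ˢ 𝓝 z, (popuc β (α q.1) (n q.1 + 1)).eval q.2 ≠ 0 := by
    filter_upwards [hz.prod_mk (Metric.ball_mem_nhds z hδ)] with q ⟨hq, hball⟩ h0
    exact (hq q.2 h0).not_gt (by rwa [← dist_eq_norm, dist_comm])
  refine ⟨hres, hne, ?_⟩
  refine ((innerSL ℂ vecE0).continuous.tendsto _ |>.comp
    (tendsto_resolvent_apply hT hres hstrong hδ hdist vecE0)).congr' ?_
  exact hne.mono fun q hq => hm q.1 q.2 hq

theorem ratioTendsto_opucStar_popuc {ι : Type*} {l : Filter ι} {α : ι → ℕ → ℂ} {n : ι → ℕ}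
    {β m z : ℂ} (h : ∀ i k, ‖α i k‖ ≤ 1) (hβ : ‖β‖ = 1)
    (hm : RatioTendsto l (fun i => opuc (α i) (n i)) (fun i => popuc β (α i) (n i + 1)) z m) :
    RatioTendsto l (fun i => opucStar (α i) (n i)) (fun i => popuc β (α i) (n i + 1)) z
      (β * (z * m - 1)) := by
  refine ((hm.X_mul.sub hm.self).C_mul tendsto_const_nhds).congr (.of_forall fun i => ?_) .rfl
  have hC : (C β * C (conj β) : ℂ[X]) = 1 := by
    rw [← C_mul, mul_comm, conj_mul_self_of_norm_eq_one hβ, C_1]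
  simp only [popuc_succ (h i) hβ]
  linear_combination opucStar (α i) (n i) * hC

/-! ### The `m`-function and the Schur function -/

section

variable {γ : ℕ → ℂ} {β z : ℂ}

theorem mem_resolventSet_cmvOperator (h : ∀ n, ‖γ n‖ ≤ 1) (hz : ‖z‖ ≠ 1) :
    z ∈ resolventSet ℂ (cmvOperator γ) :=
  not_not.1 fun hc => hz (spectrum.norm_eq_one_of_unitary (cmvOperator_mem_unitary h) hc)

theorem two_mul_re_mul_mFun (h : ∀ n, ‖γ n‖ ≤ 1) (hz : z ∈ resolventSet ℂ (cmvOperator γ)) :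
    2 * (z * mFun γ z).re = 1 + (‖z‖ ^ 2 - 1) * ‖resolvent (cmvOperator γ) z vecE0‖ ^ 2 := by
  rw [mFun, two_mul_re_mul_inner_resolvent (norm_cmvOperator_apply h) hz, norm_vecE0, one_pow]

theorem mFun_ne_zero (h : ∀ n, ‖γ n‖ ≤ 1) (hz : z ∈ resolventSet ℂ (cmvOperator γ))
    (hz1 : 1 ≤ ‖z‖) : mFun γ z ≠ 0 := by
  intro h0
  have hre := two_mul_re_mul_mFun h hz
  rw [h0, mul_zero, Complex.zero_re, mul_zero] at hre
  have hpos : 0 ≤ ‖z‖ ^ 2 - 1 := sub_nonneg.2 (one_le_pow₀ hz1)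
  nlinarith [mul_nonneg hpos (sq_nonneg ‖resolvent (cmvOperator γ) z vecE0‖)]

theorem mul_mFun_ne_one (h : ∀ n, ‖γ n‖ ≤ 1) (hz : z ∈ resolventSet ℂ (cmvOperator γ))
    (hz1 : ‖z‖ ≤ 1) : z * mFun γ z ≠ 1 := by
  intro h0
  have hre := two_mul_re_mul_mFun h hz
  rw [h0, Complex.one_re] at hre
  have hpos : 0 ≤ 1 - ‖z‖ ^ 2 := sub_nonneg.2 (pow_le_one₀ (norm_nonneg z) hz1)
  nlinarith [mul_nonneg hpos (sq_nonneg ‖resolvent (cmvOperator γ) z vecE0‖)]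

theorem conj_mFun_inv_conj (h : ∀ n, ‖γ n‖ ≤ 1) (hz : z ∈ resolventSet ℂ (cmvOperator γ))
    (hz0 : z ≠ 0) : conj (mFun γ (conj z)⁻¹) = z * (1 - z * mFun γ z) := by
  have hstar := star_resolvent_inv_conj (cmvOperator_mem_unitary h) hz hz0
  rw [mFun, inner_conj_symm, ← ContinuousLinearMap.adjoint_inner_right,
    ← ContinuousLinearMap.star_eq_adjoint, hstar]
  simp [mFun, inner_sub_right, inner_smul_right, norm_vecE0, inner_self_eq_norm_sq_to_K]

theorem analyticAt_mFun (hz : z ∈ resolventSet ℂ (cmvOperator γ)) : AnalyticAt ℂ (mFun γ) z := by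
  have hd : DifferentiableOn ℂ (mFun γ) (resolventSet ℂ (cmvOperator γ)) := fun w hw =>
    ((innerSL ℂ vecE0).hasFDerivAt.comp_hasDerivAt w
      ((spectrum.hasDerivAt_resolvent_const_left hw).clm_apply
        (hasDerivAt_const w vecE0))).differentiableAt.differentiableWithinAt
  exact hd.analyticAt ((spectrum.isOpen_resolventSet _).mem_nhds hz)

theorem caraFun_eq (hz : z ∈ resolventSet ℂ (cmvOperator γ)) :
    caraFun γ z = 1 - 2 * (z * mFun γ z) := by
  have hinv : Ring.inverse (cmvOperator γ - algebraMap ℂ (Ell2 →L[ℂ] Ell2) z) =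
      -resolvent (cmvOperator γ) z := by
    obtain ⟨u, hu⟩ : IsUnit (algebraMap ℂ (Ell2 →L[ℂ] Ell2) z - cmvOperator γ) := hz
    rw [resolvent, ← neg_sub, ← hu, ← Units.val_neg, Ring.inverse_unit, Ring.inverse_unit,
      inv_neg, Units.val_neg]
  have hvec : ((cmvOperator γ + algebraMap ℂ (Ell2 →L[ℂ] Ell2) z) *
      -resolvent (cmvOperator γ) z) vecE0 =
        vecE0 - (2 * z) • resolvent (cmvOperator γ) z vecE0 := by
    have hres : cmvOperator γ (resolvent (cmvOperator γ) z vecE0) =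
        z • resolvent (cmvOperator γ) z vecE0 - vecE0 := by
      rw [eq_sub_iff_add_eq, ← eq_sub_iff_add_eq', sub_apply_resolvent hz]
    simp only [Algebra.algebraMap_eq_smul_one, mul_neg, neg_apply, mul_apply_eq_comp,
      add_apply, smul_apply, one_apply_eq_self]
    rw [hres]
    module
  rw [caraFun, hinv, hvec, inner_sub_right, inner_smul_right, inner_self_eq_norm_sq_to_K,
    norm_vecE0, mFun]
  push_cast
  ring

theorem caraFun_eq_neg_one_iff (hz : z ∈ resolventSet ℂ (cmvOperator γ)) :
    caraFun γ z = -1 ↔ z * mFun γ z = 1 := by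
  rw [caraFun_eq hz]
  constructor <;> intro h
  · linear_combination -h / 2
  · linear_combination -2 * h

theorem schurQuot_eq_infty (hz : z ∈ resolventSet ℂ (cmvOperator γ)) (h1 : z * mFun γ z = 1) :
    schurQuot γ z = OnePoint.infty :=
  if_pos ((caraFun_eq_neg_one_iff hz).2 h1)

theorem schurQuot_eq_coe (hz : z ∈ resolventSet ℂ (cmvOperator γ)) (hz0 : z ≠ 0)
    (h1 : z * mFun γ z ≠ 1) :
    schurQuot γ z = ((mFun γ z / (z * mFun γ z - 1) : ℂ) : OnePoint ℂ) := by
  have h1' : z * mFun γ z - 1 ≠ 0 := sub_ne_zero.2 h1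
  rw [schurQuot, if_neg (mt (caraFun_eq_neg_one_iff hz).1 h1), caraFun_eq hz,
    show 1 - 2 * (z * mFun γ z) + 1 = -2 * (z * mFun γ z - 1) by ring]
  congr 1
  field_simp
  ring

theorem mFun_mul_relation_of_norm_ne_one (h : ∀ n, ‖γ n‖ ≤ 1) (hβ : ‖β‖ = 1) (hz : ‖z‖ ≠ 1) :
    mFun γ z * (β * (z * mFun (fun n => γ n * β) z - 1)) =
      mFun (fun n => γ n * β) z * (z * mFun γ z - 1) := by
  let α : ℕ → ℕ → ℂ := fun i m => -conj (γ (i - 1 - m))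
  have hα (i m : ℕ) : ‖α i m‖ ≤ 1 := by
    rw [norm_neg, RCLike.norm_conj]
    exact h _
  have hlim (m : ℕ) : Tendsto (fun i => -conj (α i (i - 1 - m))) atTop (𝓝 (γ m)) := by
    refine tendsto_const_nhds.congr' ((eventually_gt_atTop m).mono fun i hi => ?_)
    change γ m = -conj (-conj (γ (i - 1 - (i - 1 - m))))
    rw [map_neg, neg_neg, Complex.conj_conj, show i - 1 - (i - 1 - m) = m by omega]
  have hratio {b : ℂ} (hb : ‖b‖ = 1) := (ratioTendsto_opuc_popuc hα hb tendsto_id hlim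
    (abs_pos.2 (sub_ne_zero.2 hz)) (.of_forall fun i w hw => by
      simpa only [norm_eq_one_of_popuc_eval_eq_zero (hα i) hb hw] using
        abs_norm_sub_norm_le z w)).2
  have h1 := hratio norm_one
  have hstar1 := ratioTendsto_opucStar_popuc hα norm_one h1
  have hstarβ := ratioTendsto_opucStar_popuc hα hβ (hratio hβ)
  simp only [mul_one, one_mul] at h1 hstar1
  rw [mul_comm (mFun (fun n => γ n * β) z)]
  exact (h1.mul hstarβ).unique
    ((hstar1.mul (hratio hβ)).congr (.of_forall fun i => mul_comm _ _) .rfl)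

theorem dense_norm_ne_one_and_ne_zero : Dense {w : ℂ | ‖w‖ ≠ 1 ∧ w ≠ 0} := by
  have hsphere : Dense (Metric.sphere (0 : ℂ) 1)ᶜ := by
    rw [← interior_eq_empty_iff_dense_compl, interior_sphere _ one_ne_zero]
  convert hsphere.inter_of_isOpen_left (dense_compl_singleton (0 : ℂ))
    Metric.isClosed_sphere.isOpen_compl using 1
  ext w
  simp

theorem mFun_mul_relation (h : ∀ n, ‖γ n‖ ≤ 1) (hβ : ‖β‖ = 1)
    (hz : z ∈ resolventSet ℂ (cmvOperator γ))
    (hzβ : z ∈ resolventSet ℂ (cmvOperator fun n => γ n * β)) :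
    mFun γ z * (β * (z * mFun (fun n => γ n * β) z - 1)) =
      mFun (fun n => γ n * β) z * (z * mFun γ z - 1) := by
  have hc := (analyticAt_mFun hz).continuousAt
  have hcβ := (analyticAt_mFun hzβ).continuousAt
  have hleft := hc.mul
    (((continuousAt_id.mul hcβ).sub (continuousAt_const (y := (1 : ℂ)))).const_mul β)
  have hright := hcβ.mul ((continuousAt_id.mul hc).sub (continuousAt_const (y := (1 : ℂ))))
  have : (𝓝[{w : ℂ | ‖w‖ ≠ 1 ∧ w ≠ 0}] z).NeBot :=
    mem_closure_iff_nhdsWithin_neBot.1 (dense_norm_ne_one_and_ne_zero z)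
  refine tendsto_nhds_unique_of_eventuallyEq (l := 𝓝[{w : ℂ | ‖w‖ ≠ 1 ∧ w ≠ 0}] z)
    (hleft.mono_left nhdsWithin_le_nhds) (hright.mono_left nhdsWithin_le_nhds) ?_
  filter_upwards [self_mem_nhdsWithin] with w hw
  exact mFun_mul_relation_of_norm_ne_one h hβ hw.1

theorem mul_mFun_eq_one_iff (h : ∀ n, ‖γ n‖ ≤ 1) (hβ : ‖β‖ = 1)
    (hz : z ∈ resolventSet ℂ (cmvOperator γ))
    (hzβ : z ∈ resolventSet ℂ (cmvOperator fun n => γ n * β)) :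
    z * mFun γ z = 1 ↔ z * mFun (fun n => γ n * β) z = 1 := by
  have hβ0 : β ≠ 0 := norm_ne_zero_iff.1 (hβ ▸ one_ne_zero)
  have hrel := mFun_mul_relation h hβ hz hzβ
  constructor <;> intro h1
  · rw [h1, sub_self, mul_zero] at hrel
    exact sub_eq_zero.1 ((mul_eq_zero.1 ((mul_eq_zero.1 hrel).resolve_left
      (right_ne_zero_of_mul_eq_one h1))).resolve_left hβ0)
  · rw [h1, sub_self, mul_zero, mul_zero, zero_eq_mul] at hrel
    exact sub_eq_zero.1 (hrel.resolve_left (right_ne_zero_of_mul_eq_one h1))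

theorem schurQuot_eq_coe_mul (h : ∀ n, ‖γ n‖ ≤ 1) (hβ : ‖β‖ = 1)
    (hz : z ∈ resolventSet ℂ (cmvOperator γ)) (hz0 : z ≠ 0)
    (hzβ : z ∈ resolventSet ℂ (cmvOperator fun n => γ n * β))
    (h1 : z * mFun (fun n => γ n * β) z ≠ 1) :
    schurQuot γ z = ((mFun (fun n => γ n * β) z /
      (β * (z * mFun (fun n => γ n * β) z - 1)) : ℂ) : OnePoint ℂ) := by
  have hβ0 : β ≠ 0 := norm_ne_zero_iff.1 (hβ ▸ one_ne_zero)
  have h1' := mt (mul_mFun_eq_one_iff h hβ hz hzβ).1 h1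
  rw [schurQuot_eq_coe hz hz0 h1', (div_eq_div_iff (sub_ne_zero.2 h1')
    (mul_ne_zero hβ0 (sub_ne_zero.2 h1))).2 (mFun_mul_relation h hβ hz hzβ)]

theorem schurFun_eq_infty (h : ∀ n, ‖γ n‖ ≤ 1) (hβ : ‖β‖ = 1)
    (hzβ : z ∈ resolventSet ℂ (cmvOperator fun n => γ n * β))
    (h1 : z * mFun (fun n => γ n * β) z = 1) : schurFun γ z = OnePoint.infty := by
  have hγβ (n : ℕ) : ‖γ n * β‖ ≤ 1 := by rw [norm_mul, hβ, mul_one]; exact h n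
  have hz1 : 1 < ‖z‖ := not_le.1 fun hle => mul_mFun_ne_one hγβ hzβ hle h1
  have hz := mem_resolventSet_cmvOperator h hz1.ne'
  rw [schurFun, if_pos ⟨hz, left_ne_zero_of_mul_eq_one h1⟩]
  exact schurQuot_eq_infty hz ((mul_mFun_eq_one_iff h hβ hz hzβ).2 h1)

theorem schurFun_eq_coe (h : ∀ n, ‖γ n‖ ≤ 1) (hβ : ‖β‖ = 1)
    (hzβ : z ∈ resolventSet ℂ (cmvOperator fun n => γ n * β))
    (h1 : z * mFun (fun n => γ n * β) z ≠ 1) :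
    schurFun γ z = ((mFun (fun n => γ n * β) z /
      (β * (z * mFun (fun n => γ n * β) z - 1)) : ℂ) : OnePoint ℂ) := by
  rw [schurFun]
  split_ifs with hz
  · exact schurQuot_eq_coe_mul h hβ hz.1 hz.2 hzβ h1
  set S := resolventSet ℂ (cmvOperator γ) \ {0}
  have : (𝓝[S] z).NeBot := mem_closure_iff_nhdsWithin_neBot.1 <|
    dense_norm_ne_one_and_ne_zero.mono (show _ ⊆ S from fun w hw =>
      ⟨mem_resolventSet_cmvOperator h hw.1, hw.2⟩) z
  have hβ0 : β ≠ 0 := norm_ne_zero_iff.1 (hβ ▸ one_ne_zero)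
  have hc := (analyticAt_mFun hzβ).continuousAt
  have hden := continuousAt_id.mul hc
  have hquot := hc.div ((hden.sub (continuousAt_const (y := (1 : ℂ)))).const_mul β)
    (mul_ne_zero hβ0 (sub_ne_zero.2 h1))
  refine Tendsto.limUnder_eq ((((OnePoint.continuous_coe.tendsto _).comp hquot).mono_left
    nhdsWithin_le_nhds).congr' ?_)
  filter_upwards [mem_nhdsWithin_of_mem_nhds ((spectrum.isOpen_resolventSet _).mem_nhds hzβ),
    (hden.eventually_ne h1).filter_mono nhdsWithin_le_nhds, self_mem_nhdsWithin] with w hw hw1 hwS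
  exact (schurQuot_eq_coe_mul h hβ hwS.1 hwS.2 hw hw1).symm

theorem finVal_schurFun (h : ∀ n, ‖γ n‖ ≤ 1) (hβ : ‖β‖ = 1)
    (hzβ : z ∈ resolventSet ℂ (cmvOperator fun n => γ n * β))
    (h1 : z * mFun (fun n => γ n * β) z ≠ 1) :
    finVal (schurFun γ z) =
      mFun (fun n => γ n * β) z / (β * (z * mFun (fun n => γ n * β) z - 1)) := by
  rw [schurFun_eq_coe h hβ hzβ h1]
  rfl

theorem recipVal_schurFun (h : ∀ n, ‖γ n‖ ≤ 1) (hβ : ‖β‖ = 1)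
    (hzβ : z ∈ resolventSet ℂ (cmvOperator fun n => γ n * β)) :
    recipVal (schurFun γ z) =
      β * (z * mFun (fun n => γ n * β) z - 1) / mFun (fun n => γ n * β) z := by
  by_cases h1 : z * mFun (fun n => γ n * β) z = 1
  · rw [schurFun_eq_infty h hβ hzβ h1, h1, sub_self, mul_zero, zero_div]
    rfl
  · rw [schurFun_eq_coe h hβ hzβ h1]
    exact inv_div _ _

theorem mul_mFun_ne_one_of_notMem_poleSet (h : ∀ n, ‖γ n‖ ≤ 1) (hβ : ‖β‖ = 1)
    (hzβ : z ∈ resolventSet ℂ (cmvOperator fun n => γ n * β)) (hz : z ∉ poleSet (schurFun γ)) :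
    z * mFun (fun n => γ n * β) z ≠ 1 := fun h1 =>
  have hγβ (n : ℕ) : ‖γ n * β‖ ≤ 1 := by rw [norm_mul, hβ, mul_one]; exact h n
  hz ⟨not_le.1 fun hle => mul_mFun_ne_one hγβ hzβ hle h1, schurFun_eq_infty h hβ hzβ h1⟩

theorem mFun_ne_zero_of_notMem_zeroSet (h : ∀ n, ‖γ n‖ ≤ 1) (hβ : ‖β‖ = 1)
    (hzβ : z ∈ resolventSet ℂ (cmvOperator fun n => γ n * β)) (hz : z ∉ zeroSet (schurFun γ)) :
    mFun (fun n => γ n * β) z ≠ 0 := fun h0 =>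
  have hγβ (n : ℕ) : ‖γ n * β‖ ≤ 1 := by rw [norm_mul, hβ, mul_one]; exact h n
  hz ⟨not_le.1 fun hle => mFun_ne_zero hγβ hzβ hle h0, by
    rw [schurFun_eq_coe h hβ hzβ (by simp [h0]), h0, zero_div]⟩

end

/-! ### Sequences with a limiting ratio -/

theorem RatioSeq.sub_add {t : ℝ} {n N : ℕ → ℕ} (h : RatioSeq t n N) (s c : ℕ) :
    RatioSeq t (fun i => n i - s + c) N := by
  obtain ⟨hn, hN, hlim⟩ := h
  refine ⟨tendsto_atTop_mono (fun i => Nat.le_add_right _ c)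
    ((tendsto_sub_atTop_nat s).comp hn), hN, ?_⟩
  have hshift : Tendsto (fun i => ((c : ℝ) - s) / N i) atTop (𝓝 0) :=
    tendsto_const_nhds.div_atTop (tendsto_natCast_atTop_atTop.comp hN)
  rw [← add_zero t]
  refine (hlim.add hshift).congr' ((hn.eventually_ge_atTop s).mono fun i hi => ?_)
  change _ = ((n i - s + c : ℕ) : ℝ) / N i
  rw [← add_div, Nat.cast_add, Nat.cast_sub hi, sub_add_eq_add_sub, add_sub_assoc]

theorem exists_ratioSeq {p : ℕ} (hp : 1 ≤ p) {t : ℝ} (ht : 0 ≤ t) :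
    ∃ k N : ℕ → ℕ, RatioSeq t (fun i => k i * p) N := by
  have hp0 : (p : ℝ) ≠ 0 := Nat.cast_ne_zero.2 (by omega)
  have hsq : Tendsto (fun i : ℕ => i ^ 2) atTop atTop := tendsto_pow_atTop two_ne_zero
  refine ⟨fun i => ⌊t / p * (i : ℝ) ^ 2⌋₊ + i, fun i => i ^ 2,
    tendsto_atTop_mono (fun i => (Nat.le_add_left i _).trans (Nat.le_mul_of_pos_right _ hp))
      tendsto_id, hsq, ?_⟩
  have hfloor : Tendsto (fun i : ℕ => (⌊t / p * ((i ^ 2 : ℕ) : ℝ)⌋₊ : ℝ) / ((i ^ 2 : ℕ) : ℝ))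
      atTop (𝓝 (t / p)) :=
    (tendsto_nat_floor_mul_div_atTop (div_nonneg ht p.cast_nonneg)).comp
      (tendsto_natCast_atTop_atTop.comp hsq)
  have hlim := (hfloor.add tendsto_inv_atTop_nhds_zero_nat).mul_const (p : ℝ)
  rw [add_zero, div_mul_cancel₀ t hp0] at hlim
  refine hlim.congr' ((eventually_gt_atTop 0).mono fun i hi => ?_)
  have hi0 : (i : ℝ) ≠ 0 := Nat.cast_ne_zero.2 hi.ne'
  push_cast
  field_simp

theorem exists_le_norm_sub_of_notMem_limZeros {t : ℝ} {α : ℕ → ℕ → ℂ} {β z : ℂ} {n N : ℕ → ℕ}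
    (h : ∀ n N, ‖α n N‖ ≤ 1) (hβ : ‖β‖ = 1) (hs : RatioSeq t (fun i => n i + 1) N)
    (hz : z ∉ limZeros α β t) :
    ∃ δ > 0, ∀ᶠ i in atTop, ∀ w,
      (popuc β (fun l => α l (N i)) (n i + 1)).eval w = 0 → δ ≤ ‖z - w‖ := by
  have hcircle (i : ℕ) {w : ℂ} (hw : (popuc β (fun l => α l (N i)) (n i + 1)).eval w = 0) :
      ‖w‖ = 1 := norm_eq_one_of_popuc_eval_eq_zero (fun m => h m (N i)) hβ hw
  by_cases hz1 : ‖z‖ = 1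
  · obtain ⟨ε, hε0, hε⟩ := exists_between (pos_iff_ne_zero.2 fun h0 => hz ⟨hz1, _, N, hs, h0⟩)
    refine ⟨ε.toReal, ENNReal.toReal_pos hε0.ne' hε.ne_top, ?_⟩
    filter_upwards [eventually_lt_of_lt_liminf hε] with i hi w hw
    rw [← dist_eq_norm, dist_edist]
    exact ENNReal.toReal_mono (edist_ne_top _ _)
      (hi.le.trans (Metric.infEDist_le_edist_of_mem ⟨hcircle i hw, hw⟩))
  · refine ⟨|‖z‖ - 1|, abs_pos.2 (sub_ne_zero.2 hz1), .of_forall fun i w hw => ?_⟩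
    simpa only [hcircle i hw] using abs_norm_sub_norm_le z w

theorem ratioLimit_of_ratioTendsto {p : ℕ} {t : ℝ} {num den : ℕ → ℕ → ℂ[X]} {L : ℂ → ℂ}
    {U : Set ℂ} (h : ∀ k N : ℕ → ℕ, RatioSeq t (fun i => k i * p) N → ∀ z ∈ U,
      RatioTendsto atTop (fun i => num (k i) (N i)) (fun i => den (k i) (N i)) z (L z)) :
    RatioLimit p t num den L U := fun k N hs _ hKU hK =>
  RatioTendsto.tendstoUniformlyOn hK fun z hz => h k N hs z (hKU hz)

namespace RatioTendsto

variable {ι : Type*} {l : Filter ι} {α : ι → ℕ → ℂ} {n : ι → ℕ} {P : ι → ℂ[X]} {c x y z : ℂ}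

theorem opuc_succ (hx : RatioTendsto l (fun i => opuc (α i) (n i)) P z x)
    (hy : RatioTendsto l (fun i => opucStar (α i) (n i)) P z y) (h : ∀ i m, ‖α i m‖ ≤ 1)
    (hc : Tendsto (fun i => α i (n i)) l (𝓝 c)) :
    RatioTendsto l (fun i => opuc (α i) (n i + 1)) P z (z * x - conj c * y) :=
  (hx.X_mul.sub (hy.C_mul ((Complex.continuous_conj.tendsto c).comp hc))).congr
    (.of_forall fun i => (_root_.opuc_succ (h i) (n i)).symm) .rfl

theorem opucStar_succ (hx : RatioTendsto l (fun i => opuc (α i) (n i)) P z x)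
    (hy : RatioTendsto l (fun i => opucStar (α i) (n i)) P z y) (h : ∀ i m, ‖α i m‖ ≤ 1)
    (hc : Tendsto (fun i => α i (n i)) l (𝓝 c)) :
    RatioTendsto l (fun i => opucStar (α i) (n i + 1)) P z (y - c * (z * x)) :=
  (hy.sub (hx.X_mul.C_mul hc)).congr
    (.of_forall fun i => (_root_.opucStar_succ (h i) (n i)).symm) .rfl

theorem popuc_succ {β : ℂ} (hx : RatioTendsto l (fun i => opuc (α i) (n i)) P z x)
    (hy : RatioTendsto l (fun i => opucStar (α i) (n i)) P z y) (h : ∀ i m, ‖α i m‖ ≤ 1)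
    (hβ : ‖β‖ = 1) :
    RatioTendsto l (fun i => popuc β (α i) (n i + 1)) P z (z * x - conj β * y) :=
  (hx.X_mul.sub (hy.C_mul tendsto_const_nhds)).congr
    (.of_forall fun i => (_root_.popuc_succ (h i) hβ (n i)).symm) .rfl

end RatioTendsto

/-! ### Periodic limits -/

/-- The coefficients `α n N` lie in the closed unit disk and converge to the `p`-periodic
sequence `a` as `k p / N → t`. -/
structure PeriodicLimit (p : ℕ) (t : ℝ) (α : ℕ → ℕ → ℂ) (a : ℤ → ℂ) : Prop where
  one_le : 1 ≤ p
  nonneg : 0 ≤ t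
  norm_le : ∀ n N, ‖α n N‖ ≤ 1
  periodic : ∀ n, a (n + p) = a n
  lim : ∀ j < p, ∀ k N : ℕ → ℕ, RatioSeq t (fun i => k i * p) N →
    Tendsto (fun i => α (k i * p + j) (N i)) atTop (𝓝 (a j))

theorem revCoeff_mul (p : ℕ) (a : ℤ → ℂ) (β : ℂ) (j : ℕ) :
    (fun n => revCoeff p a 1 j n * β) = revCoeff p a β j := by
  funext n
  rw [revCoeff, revCoeff, mul_one]

namespace PeriodicLimit

variable {p : ℕ} {t : ℝ} {α : ℕ → ℕ → ℂ} {a : ℤ → ℂ} {k N : ℕ → ℕ} {β z : ℂ}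

theorem tendsto_sub (h : PeriodicLimit p t α a) (hs : RatioSeq t (fun i => k i * p) N) (s : ℕ) :
    Tendsto (fun i => α (k i * p - s) (N i)) atTop (𝓝 (a (p - s))) := by
  have hp := h.one_le
  obtain ⟨c, r, hr, hc⟩ : ∃ c r : ℕ, r < p ∧ s + r = c * p := by
    refine ⟨(s + (p - 1)) / p, p - 1 - (s + (p - 1)) % p, by omega, ?_⟩
    have hdiv := Nat.div_add_mod' (s + (p - 1)) p
    have hmod := Nat.mod_lt (s + (p - 1)) hp
    omega
  have hs' : RatioSeq t (fun i => (k i - c) * p) N := by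
    simpa only [Nat.sub_mul, add_zero] using hs.sub_add (c * p) 0
  have ha : a (p - s) = a r := by
    have hcZ : (s : ℤ) + r = c * p := mod_cast hc
    rw [sub_eq_neg_add, h.periodic, ← Function.Periodic.sub_nat_mul_eq (x := (r : ℤ)) h.periodic c,
      ← hcZ, sub_add_cancel_right]
  rw [ha]
  refine (h.lim r hr _ N hs').congr' ((hs.1.eventually_ge_atTop (c * p)).mono fun i hi => ?_)
  congr 1
  rw [Nat.sub_mul]
  omega

theorem norm_revCoeff_le (h : PeriodicLimit p t α a) (hβ : ‖β‖ = 1) (j n : ℕ) :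
    ‖revCoeff p a β j n‖ ≤ 1 := by
  obtain ⟨k, N, hs⟩ := exists_ratioSeq h.one_le h.nonneg
  have hlim := h.tendsto_sub hs (1 + (n + j))
  rw [Nat.cast_add, ← sub_sub, Nat.cast_one] at hlim
  rw [revCoeff, norm_mul, norm_neg, RCLike.norm_conj, hβ, mul_one]
  exact le_of_tendsto' hlim.norm fun i => h.norm_le _ _

theorem ratioTendsto (h : PeriodicLimit p t α a) (hs : RatioSeq t (fun i => k i * p) N)
    (hβ : ‖β‖ = 1) (j : ℕ) (hz : z ∉ limZeros α β t) :
    z ∈ resolventSet ℂ (cmvOperator (revCoeff p a β j)) ∧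
      RatioTendsto atTop (fun i => opuc (fun l => α l (N i)) (k i * p - j))
        (fun i => popuc β (fun l => α l (N i)) (k i * p - j + 1)) z
        (mFun (revCoeff p a β j) z) := by
  have hlim (m : ℕ) : Tendsto (fun i => -conj (α (k i * p - j - 1 - m) (N i))) atTop
      (𝓝 (revCoeff p a 1 j m)) := by
    have hm := h.tendsto_sub hs (1 + (m + j))
    rw [Nat.cast_add, ← sub_sub, Nat.cast_one] at hm
    rw [revCoeff, mul_one]
    refine ((Complex.continuous_conj.tendsto _).comp hm).neg.congr fun i => ?_
    rw [Function.comp_apply, Nat.sub_sub, Nat.sub_sub, show 1 + (m + j) = j + (1 + m) by ring]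
  obtain ⟨δ, hδ, hdist⟩ :=
    exists_le_norm_sub_of_notMem_limZeros h.norm_le hβ (hs.sub_add j 1) hz
  have hratio := ratioTendsto_opuc_popuc (α := fun i l => α l (N i)) (fun i m => h.norm_le m (N i))
    hβ ((tendsto_sub_atTop_nat j).comp hs.1) hlim hδ hdist
  rwa [revCoeff_mul] at hratio

theorem mem_resolventSet (h : PeriodicLimit p t α a) (hβ : ‖β‖ = 1) (j : ℕ)
    (hz : z ∉ limZeros α β t) : z ∈ resolventSet ℂ (cmvOperator (revCoeff p a β j)) := by
  obtain ⟨k, N, hs⟩ := exists_ratioSeq h.one_le h.nonneg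
  exact (h.ratioTendsto hs hβ j hz).1

theorem mem_resolventSet_mul (h : PeriodicLimit p t α a) (hβ : ‖β‖ = 1) (j : ℕ)
    (hz : z ∉ limZeros α β t) :
    z ∈ resolventSet ℂ (cmvOperator fun n => revCoeff p a 1 j n * β) := by
  rw [revCoeff_mul]
  exact h.mem_resolventSet hβ j hz

theorem ratioTendsto_star (h : PeriodicLimit p t α a) (hs : RatioSeq t (fun i => k i * p) N)
    (hβ : ‖β‖ = 1) (j : ℕ) (hz : z ∉ limZeros α β t) :
    RatioTendsto atTop (fun i => opucStar (fun l => α l (N i)) (k i * p - j))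
      (fun i => popuc β (fun l => α l (N i)) (k i * p - j + 1)) z
      (β * (z * mFun (revCoeff p a β j) z - 1)) :=
  ratioTendsto_opucStar_popuc (fun i m => h.norm_le m (N i)) hβ (h.ratioTendsto hs hβ j hz).2

/-! ### The Schur function of the limit -/

theorem mul_mFun_ne_one (h : PeriodicLimit p t α a) (hβ : ‖β‖ = 1) (j : ℕ)
    (hz : z ∉ limZeros α β t) (hP : z ∉ poleSet (schurFun (revCoeff p a 1 j))) :
    z * mFun (revCoeff p a β j) z ≠ 1 := by
  rw [← revCoeff_mul]
  exact mul_mFun_ne_one_of_notMem_poleSet (h.norm_revCoeff_le norm_one j) hβ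
    (h.mem_resolventSet_mul hβ j hz) hP

theorem mFun_ne_zero (h : PeriodicLimit p t α a) (hβ : ‖β‖ = 1) (j : ℕ)
    (hz : z ∉ limZeros α β t) (hZ : z ∉ zeroSet (schurFun (revCoeff p a 1 j))) :
    mFun (revCoeff p a β j) z ≠ 0 := by
  rw [← revCoeff_mul]
  exact mFun_ne_zero_of_notMem_zeroSet (h.norm_revCoeff_le norm_one j) hβ
    (h.mem_resolventSet_mul hβ j hz) hZ

theorem finVal_schurFun (h : PeriodicLimit p t α a) (hβ : ‖β‖ = 1) (j : ℕ)
    (hz : z ∉ limZeros α β t) (h1 : z * mFun (revCoeff p a β j) z ≠ 1) :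
    finVal (schurFun (revCoeff p a 1 j) z) =
      mFun (revCoeff p a β j) z / (β * (z * mFun (revCoeff p a β j) z - 1)) := by
  rw [← revCoeff_mul p a β] at h1 ⊢
  exact _root_.finVal_schurFun (h.norm_revCoeff_le norm_one j) hβ
    (h.mem_resolventSet_mul hβ j hz) h1

theorem recipVal_schurFun (h : PeriodicLimit p t α a) (hβ : ‖β‖ = 1) (j : ℕ)
    (hz : z ∉ limZeros α β t) :
    recipVal (schurFun (revCoeff p a 1 j) z) =
      β * (z * mFun (revCoeff p a β j) z - 1) / mFun (revCoeff p a β j) z := by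
  rw [← revCoeff_mul p a β]
  exact _root_.recipVal_schurFun (h.norm_revCoeff_le norm_one j) hβ (h.mem_resolventSet_mul hβ j hz)

theorem ratioTendsto_opuc_opucStar (h : PeriodicLimit p t α a)
    (hs : RatioSeq t (fun i => k i * p) N) (j : ℕ) (hz : z ∉ limZerosAll α t)
    (hP : z ∉ poleSet (schurFun (revCoeff p a 1 j))) :
    RatioTendsto atTop (fun i => opuc (fun l => α l (N i)) (k i * p - j))
      (fun i => opucStar (fun l => α l (N i)) (k i * p - j)) z
      (finVal (schurFun (revCoeff p a 1 j) z)) := by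
  obtain ⟨β, hβ, hzβ⟩ : ∃ β : ℂ, ‖β‖ = 1 ∧ z ∉ limZeros α β t := by
    simpa [limZerosAll] using hz
  have hne := h.mul_mFun_ne_one hβ j hzβ hP
  rw [h.finVal_schurFun hβ j hzβ hne]
  exact (h.ratioTendsto hs hβ j hzβ).2.div (h.ratioTendsto_star hs hβ j hzβ)
    (mul_ne_zero (norm_ne_zero_iff.1 (hβ ▸ one_ne_zero)) (sub_ne_zero.2 hne))

theorem ratioTendsto_opucStar_opuc (h : PeriodicLimit p t α a)
    (hs : RatioSeq t (fun i => k i * p) N) (j : ℕ) (hz : z ∉ limZerosAll α t)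
    (hZ : z ∉ zeroSet (schurFun (revCoeff p a 1 j))) :
    RatioTendsto atTop (fun i => opucStar (fun l => α l (N i)) (k i * p - j))
      (fun i => opuc (fun l => α l (N i)) (k i * p - j)) z
      (recipVal (schurFun (revCoeff p a 1 j) z)) := by
  obtain ⟨β, hβ, hzβ⟩ : ∃ β : ℂ, ‖β‖ = 1 ∧ z ∉ limZeros α β t := by
    simpa [limZerosAll] using hz
  rw [h.recipVal_schurFun hβ j hzβ]
  exact (h.ratioTendsto_star hs hβ j hzβ).div (h.ratioTendsto hs hβ j hzβ).2
    (h.mFun_ne_zero hβ j hzβ hZ)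

end PeriodicLimit

/-! ### Ratios of consecutive POPUC -/

/-- The limit of `Φ^{(β)}_{kp-j+1} / Φ^{(β)}_{kp-j}`. It is written in terms of the `m`-function
stripped `j + 1` times alone, so that it involves no division. -/
noncomputable def popucRatio (p : ℕ) (a : ℤ → ℂ) (β : ℂ) (j : ℕ) (z : ℂ) : ℂ :=
  z * (z * mFun (revCoeff p a β (j + 1)) z -
      conj (a (p - j - 1)) * (β * (z * mFun (revCoeff p a β (j + 1)) z - 1))) -
    conj β * (β * (z * mFun (revCoeff p a β (j + 1)) z - 1) -
      a (p - j - 1) * (z * mFun (revCoeff p a β (j + 1)) z))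

namespace PeriodicLimit

variable {p : ℕ} {t : ℝ} {α : ℕ → ℕ → ℂ} {a : ℤ → ℂ} {k N : ℕ → ℕ} {β z : ℂ}

theorem tendsto_sub_succ (h : PeriodicLimit p t α a) (hs : RatioSeq t (fun i => k i * p) N)
    (j : ℕ) : Tendsto (fun i => α (k i * p - (j + 1)) (N i)) atTop (𝓝 (a (p - j - 1))) := by
  simpa only [Nat.cast_succ, sub_sub] using h.tendsto_sub hs (j + 1)

theorem eventually_sub_succ_add_one (hs : RatioSeq t (fun i => k i * p) N) (j : ℕ) :
    ∀ᶠ i in atTop, k i * p - (j + 1) + 1 = k i * p - j :=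
  (hs.1.eventually_ge_atTop (j + 1)).mono fun i hi => by omega

theorem ratioTendsto_opuc_popuc_self (h : PeriodicLimit p t α a)
    (hs : RatioSeq t (fun i => k i * p) N) (hβ : ‖β‖ = 1) (j : ℕ) (hz : z ∉ limZeros α β t) :
    RatioTendsto atTop (fun i => opuc (fun l => α l (N i)) (k i * p - j))
      (fun i => popuc β (fun l => α l (N i)) (k i * p - j)) z
      (z * mFun (revCoeff p a β (j + 1)) z -
        conj (a (p - j - 1)) * (β * (z * mFun (revCoeff p a β (j + 1)) z - 1))) := by
  have hidx := eventually_sub_succ_add_one hs j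
  exact ((h.ratioTendsto hs hβ (j + 1) hz).2.opuc_succ (h.ratioTendsto_star hs hβ (j + 1) hz)
    (fun i m => h.norm_le m (N i)) (h.tendsto_sub_succ hs j)).congr
    (hidx.mono fun i hi => congrArg _ hi) (hidx.mono fun i hi => congrArg _ hi)

theorem ratioTendsto_opucStar_popuc_self (h : PeriodicLimit p t α a)
    (hs : RatioSeq t (fun i => k i * p) N) (hβ : ‖β‖ = 1) (j : ℕ) (hz : z ∉ limZeros α β t) :
    RatioTendsto atTop (fun i => opucStar (fun l => α l (N i)) (k i * p - j))
      (fun i => popuc β (fun l => α l (N i)) (k i * p - j)) z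
      (β * (z * mFun (revCoeff p a β (j + 1)) z - 1) -
        a (p - j - 1) * (z * mFun (revCoeff p a β (j + 1)) z)) := by
  have hidx := eventually_sub_succ_add_one hs j
  exact ((h.ratioTendsto hs hβ (j + 1) hz).2.opucStar_succ (h.ratioTendsto_star hs hβ (j + 1) hz)
    (fun i m => h.norm_le m (N i)) (h.tendsto_sub_succ hs j)).congr
    (hidx.mono fun i hi => congrArg _ hi) (hidx.mono fun i hi => congrArg _ hi)

theorem ratioTendsto_popuc (h : PeriodicLimit p t α a) (hs : RatioSeq t (fun i => k i * p) N)
    (hβ : ‖β‖ = 1) (j : ℕ) (hz : z ∉ limZeros α β t) :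
    RatioTendsto atTop (fun i => popuc β (fun l => α l (N i)) (k i * p - j + 1))
      (fun i => popuc β (fun l => α l (N i)) (k i * p - j)) z (popucRatio p a β j z) :=
  (h.ratioTendsto_opuc_popuc_self hs hβ j hz).popuc_succ
    (h.ratioTendsto_opucStar_popuc_self hs hβ j hz) (fun i m => h.norm_le m (N i)) hβ

theorem mFun_mul_popucRatio (h : PeriodicLimit p t α a) (hβ : ‖β‖ = 1) (j : ℕ)
    (hz : z ∉ limZeros α β t) :
    mFun (revCoeff p a β j) z * popucRatio p a β j z =
      z * mFun (revCoeff p a β (j + 1)) z -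
        conj (a (p - j - 1)) * (β * (z * mFun (revCoeff p a β (j + 1)) z - 1)) := by
  obtain ⟨k, N, hs⟩ := exists_ratioSeq h.one_le h.nonneg
  exact ((h.ratioTendsto hs hβ j hz).2.trans (h.ratioTendsto_popuc hs hβ j hz)).unique
    (h.ratioTendsto_opuc_popuc_self hs hβ j hz)

theorem mul_mFun_sub_one_mul_popucRatio (h : PeriodicLimit p t α a) (hβ : ‖β‖ = 1) (j : ℕ)
    (hz : z ∉ limZeros α β t) :
    β * (z * mFun (revCoeff p a β j) z - 1) * popucRatio p a β j z =
      β * (z * mFun (revCoeff p a β (j + 1)) z - 1) -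
        a (p - j - 1) * (z * mFun (revCoeff p a β (j + 1)) z) := by
  obtain ⟨k, N, hs⟩ := exists_ratioSeq h.one_le h.nonneg
  exact ((h.ratioTendsto_star hs hβ j hz).trans (h.ratioTendsto_popuc hs hβ j hz)).unique
    (h.ratioTendsto_opucStar_popuc_self hs hβ j hz)

theorem popucRatio_eq_recipVal (h : PeriodicLimit p t α a) (hβ : ‖β‖ = 1) (j : ℕ)
    (hz : z ∉ limZeros α β t) (hZ : z ∉ zeroSet (schurFun (revCoeff p a 1 j)))
    (hZ' : z ∉ zeroSet (schurFun (revCoeff p a 1 (j + 1)))) :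
    popucRatio p a β j z = mFun (revCoeff p a β (j + 1)) z / mFun (revCoeff p a β j) z *
      (z - conj (a (p - j - 1)) * recipVal (schurFun (revCoeff p a 1 (j + 1)) z)) := by
  have hm := h.mFun_ne_zero hβ j hz hZ
  have hm' := h.mFun_ne_zero hβ (j + 1) hz hZ'
  rw [h.recipVal_schurFun hβ (j + 1) hz, eq_div_of_mul_eq hm
    ((mul_comm _ _).trans (h.mFun_mul_popucRatio hβ j hz))]
  field_simp

theorem popucRatio_eq_finVal (h : PeriodicLimit p t α a) (hβ : ‖β‖ = 1) (j : ℕ)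
    (hz : z ∉ limZeros α β t) (hP : z ∉ poleSet (schurFun (revCoeff p a 1 j)))
    (hP' : z ∉ poleSet (schurFun (revCoeff p a 1 (j + 1)))) (hz0 : z ≠ 0) :
    popucRatio p a β j z = conj (mFun (revCoeff p a β (j + 1)) (conj z)⁻¹) /
        conj (mFun (revCoeff p a β j) (conj z)⁻¹) *
      (1 - z * a (p - j - 1) * finVal (schurFun (revCoeff p a 1 (j + 1)) z)) := by
  have hβ0 : β ≠ 0 := norm_ne_zero_iff.1 (hβ ▸ one_ne_zero)
  have hm := h.mul_mFun_ne_one hβ j hz hP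
  have hm' := h.mul_mFun_ne_one hβ (j + 1) hz hP'
  rw [h.finVal_schurFun hβ (j + 1) hz hm',
    conj_mFun_inv_conj (h.norm_revCoeff_le hβ j) (h.mem_resolventSet hβ j hz) hz0,
    conj_mFun_inv_conj (h.norm_revCoeff_le hβ (j + 1)) (h.mem_resolventSet hβ (j + 1) hz) hz0,
    mul_div_mul_left _ _ hz0, ← neg_sub _ (1 : ℂ), ← neg_sub _ (1 : ℂ), neg_div_neg_eq,
    eq_div_of_mul_eq (mul_ne_zero hβ0 (sub_ne_zero.2 hm))
      ((mul_comm _ _).trans (h.mul_mFun_sub_one_mul_popucRatio hβ j hz))]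
  have hden := sub_ne_zero.2 hm
  have hden' := sub_ne_zero.2 hm'
  field_simp

theorem analyticOnNhd_popucRatio (h : PeriodicLimit p t α a) (hβ : ‖β‖ = 1) (j : ℕ) :
    AnalyticOnNhd ℂ (popucRatio p a β j) (limZeros α β t)ᶜ := by
  intro z hz
  have hm := analyticAt_mFun (h.mem_resolventSet hβ (j + 1) hz)
  unfold popucRatio
  fun_prop

theorem ratioLimit_opucStar (h : PeriodicLimit p t α a) (j : ℕ) :
    RatioLimit p t
      (fun k N => opucStar (fun l => α l N) (k * p - j + 1))
      (fun k N => opucStar (fun l => α l N) (k * p - j))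
      (fun z => 1 - z * a (p - j) * finVal (schurFun (revCoeff p a 1 j) z))
      (limZerosAll α t ∪ poleSet (schurFun (revCoeff p a 1 j)))ᶜ := by
  refine ratioLimit_of_ratioTendsto fun k N hs z hz => ?_
  rw [Set.mem_compl_iff, Set.mem_union, not_or] at hz
  have hf := h.ratioTendsto_opuc_opucStar hs j hz.1 hz.2
  rw [mul_right_comm, mul_comm _ (a (p - j))]
  exact hf.opucStar_succ hf.self (fun i m => h.norm_le m (N i)) (h.tendsto_sub hs j)

theorem ratioLimit_opuc (h : PeriodicLimit p t α a) (j : ℕ) :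
    RatioLimit p t
      (fun k N => opuc (fun l => α l N) (k * p - j + 1))
      (fun k N => opuc (fun l => α l N) (k * p - j))
      (fun z => z - conj (a (p - j)) * recipVal (schurFun (revCoeff p a 1 j) z))
      (limZerosAll α t ∪ zeroSet (schurFun (revCoeff p a 1 j)))ᶜ := by
  refine ratioLimit_of_ratioTendsto fun k N hs z hz => ?_
  rw [Set.mem_compl_iff, Set.mem_union, not_or] at hz
  have hf := h.ratioTendsto_opucStar_opuc hs j hz.1 hz.2
  have hlim := hf.self.opuc_succ hf (fun i m => h.norm_le m (N i)) (h.tendsto_sub hs j)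
  rwa [mul_one] at hlim

end PeriodicLimit

theorem theorem3p5_general {p : ℕ} {t : ℝ} {α : ℕ → ℕ → ℂ} {a : ℤ → ℂ} (h : PeriodicLimit p t α a)
    {β : ℂ} (hβ : ‖β‖ = 1) (j : ℕ) :
    RatioLimit p t
      (fun k N => opuc (fun l => α l N) (k * p - j))
      (fun k N => popuc β (fun l => α l N) (k * p - j + 1))
      (mFun (revCoeff p a β j))
      (limZeros α β t)ᶜ ∧
    RatioLimit p t
      (fun k N => opuc (fun l => α l N) (k * p - j))
      (fun k N => opucStar (fun l => α l N) (k * p - j))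
      (fun z => finVal (schurFun (revCoeff p a 1 j) z))
      (limZerosAll α t ∪ poleSet (schurFun (revCoeff p a 1 j)))ᶜ ∧
    RatioLimit p t
      (fun k N => opucStar (fun l => α l N) (k * p - j + 1))
      (fun k N => opucStar (fun l => α l N) (k * p - j))
      (fun z => 1 - z * a (p - j) * finVal (schurFun (revCoeff p a 1 j) z))
      (limZerosAll α t ∪ poleSet (schurFun (revCoeff p a 1 j)))ᶜ ∧
    RatioLimit p t
      (fun k N => opuc (fun l => α l N) (k * p - j + 1))
      (fun k N => opuc (fun l => α l N) (k * p - j))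
      (fun z => z - conj (a (p - j)) * recipVal (schurFun (revCoeff p a 1 j) z))
      (limZerosAll α t ∪ zeroSet (schurFun (revCoeff p a 1 j)))ᶜ ∧
    ∃ L : ℂ → ℂ, AnalyticOnNhd ℂ L (limZeros α β t)ᶜ ∧
      (∀ z ∈ (limZeros α β t ∪ zeroSet (schurFun (revCoeff p a 1 j)) ∪
          zeroSet (schurFun (revCoeff p a 1 (j + 1))))ᶜ,
        L z = mFun (revCoeff p a β (j + 1)) z / mFun (revCoeff p a β j) z *
          (z - conj (a (p - j - 1)) * recipVal (schurFun (revCoeff p a 1 (j + 1)) z))) ∧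
      (∀ z ∈ (limZeros α β t ∪ poleSet (schurFun (revCoeff p a 1 j)) ∪
          poleSet (schurFun (revCoeff p a 1 (j + 1))) ∪ {0})ᶜ,
        L z = conj (mFun (revCoeff p a β (j + 1)) (conj z)⁻¹) /
            conj (mFun (revCoeff p a β j) (conj z)⁻¹) *
          (1 - z * a (p - j - 1) * finVal (schurFun (revCoeff p a 1 (j + 1)) z))) ∧
      RatioLimit p t
        (fun k N => popuc β (fun l => α l N) (k * p - j + 1))
        (fun k N => popuc β (fun l => α l N) (k * p - j))
        L
        (limZeros α β t)ᶜ := by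
  refine ⟨ratioLimit_of_ratioTendsto fun k N hs z hz => (h.ratioTendsto hs hβ j hz).2,
    ratioLimit_of_ratioTendsto fun k N hs z hz => ?_, h.ratioLimit_opucStar j, h.ratioLimit_opuc j,
    popucRatio p a β j, h.analyticOnNhd_popucRatio hβ j, fun z hz => ?_, fun z hz => ?_,
    ratioLimit_of_ratioTendsto fun k N hs z hz => h.ratioTendsto_popuc hs hβ j hz⟩
  all_goals simp only [Set.mem_compl_iff, Set.mem_union, Set.mem_singleton_iff, not_or] at hz
  · exact h.ratioTendsto_opuc_opucStar hs j hz.1 hz.2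
  · exact h.popucRatio_eq_recipVal hβ j hz.1.1 hz.1.2 hz.2
  · exact h.popucRatio_eq_finVal hβ j hz.1.1.1 hz.1.1.2 hz.1.2 hz.2

theorem theorem3p5 (p : ℕ) (hp : 1 ≤ p) (β : ℂ) (hβ : ‖β‖ = 1) (t : ℝ) (ht : 0 < t)
    (α : ℕ → ℕ → ℂ) (hα : ∀ n N, ‖α n N‖ < 1)
    (a : ℤ → ℂ) (ha : ∀ n, ‖a n‖ < 1) (haper : ∀ n, a (n + p) = a n) (hane : ∃ n, a n ≠ 0)
    (hlim : ∀ j < p, ∀ k N : ℕ → ℕ, RatioSeq t (fun i => k i * p) N →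
      Tendsto (fun i => α (k i * p + j) (N i)) atTop (𝓝 (a j)))
    (j : ℕ) :
    RatioLimit p t
      (fun k N => opuc (fun l => α l N) (k * p - j))
      (fun k N => popuc β (fun l => α l N) (k * p - j + 1))
      (mFun (revCoeff p a β j))
      (limZeros α β t)ᶜ ∧
    RatioLimit p t
      (fun k N => opuc (fun l => α l N) (k * p - j))
      (fun k N => opucStar (fun l => α l N) (k * p - j))
      (fun z => finVal (schurFun (revCoeff p a 1 j) z))
      (limZerosAll α t ∪ poleSet (schurFun (revCoeff p a 1 j)))ᶜ ∧
    RatioLimit p t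
      (fun k N => opucStar (fun l => α l N) (k * p - j + 1))
      (fun k N => opucStar (fun l => α l N) (k * p - j))
      (fun z => 1 - z * a (p - j) * finVal (schurFun (revCoeff p a 1 j) z))
      (limZerosAll α t ∪ poleSet (schurFun (revCoeff p a 1 j)))ᶜ ∧
    RatioLimit p t
      (fun k N => opuc (fun l => α l N) (k * p - j + 1))
      (fun k N => opuc (fun l => α l N) (k * p - j))
      (fun z => z - conj (a (p - j)) * recipVal (schurFun (revCoeff p a 1 j) z))
      (limZerosAll α t ∪ zeroSet (schurFun (revCoeff p a 1 j)))ᶜ ∧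
    ∃ L : ℂ → ℂ, AnalyticOnNhd ℂ L (limZeros α β t)ᶜ ∧
      (∀ z ∈ (limZeros α β t ∪ zeroSet (schurFun (revCoeff p a 1 j)) ∪
          zeroSet (schurFun (revCoeff p a 1 (j + 1))))ᶜ,
        L z = mFun (revCoeff p a β (j + 1)) z / mFun (revCoeff p a β j) z *
          (z - conj (a (p - j - 1)) * recipVal (schurFun (revCoeff p a 1 (j + 1)) z))) ∧
      (∀ z ∈ (limZeros α β t ∪ poleSet (schurFun (revCoeff p a 1 j)) ∪
          poleSet (schurFun (revCoeff p a 1 (j + 1))) ∪ {0})ᶜ,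
        L z = conj (mFun (revCoeff p a β (j + 1)) (conj z)⁻¹) /
            conj (mFun (revCoeff p a β j) (conj z)⁻¹) *
          (1 - z * a (p - j - 1) * finVal (schurFun (revCoeff p a 1 (j + 1)) z))) ∧
      RatioLimit p t
        (fun k N => popuc β (fun l => α l N) (k * p - j + 1))
        (fun k N => popuc β (fun l => α l N) (k * p - j))
        L
        (limZeros α β t)ᶜ :=
  theorem3p5_general ⟨hp, ht.le, fun n N => (hα n N).le, haper, hlim⟩ hβ j
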